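/- Fix $\gamma>\tfrac12$ and $\epsilon'\in(0,2\gamma-1)$. For each $N$ let $M^N$ be the $N\times N$ block diagonal matrix with Jordan blocks $B^1,\dots,B^{\ell}$, $\ell=\ell(N)$, where $B^i$ has dimension $a_i\log N$ (a positive integer; $a_i=a_i(N)$), $\sum_{i=1}^{\ell} a_i\log N=N$, eigenvalue $c_i=c_i(N)\in\mathbb C$ on the diagonal and $1$ on the superdiagonal. Let $G^N$ be an $N\times N$ random matrix with i.i.d. real standard normal entries, and let $L_N=\frac1N\sum_{j=1}^N\delta_{\lambda_j}$ be the empirical measure of the eigenvalues $\lambda_j$ of $M^N+N^{-\gamma}G^N$. Let $m_{c,r}$ be the uniform probability measure on the circle with centre $c$ and radius $r$, put $r_i=\exp((-\gamma+\tfrac12)/a_i)$ and $$\mu_N=\sum_{i=1}^{\ell}\frac{a_i\log N}{N}\,m_{c_i,r_i},\qquad \mathcal V_N=\Bigl\{z\in\mathbb C:\ \min\bigl(a_i\log N,\ \bigl|1-|z-c_i|^2\bigr|^{-1}\bigr)<N^{2\gamma-1-\epsilon'}\ \text{ for all } 1\le i\le\ell\Bigr\},$$ where $0^{-1}=\infty$.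 For a compactly supported probability measure $\rho$ on $\mathbb C$ write $U_\rho(z)=\int\log|z-x|\,d\rho(x)\in[-\infty,\infty)$. Assume $\ell(N)=o(N)$ as $N\to\infty$, and let $z=z_N\in\mathbb C$ (for instance a fixed point $z$) satisfy $z\in\mathcal V_N$ for all sufficiently large $N$. Then for every $\delta>0$, $$\lim_{N\to\infty}\mathbb P\bigl[\,U_{L_N}(z)\le U_{\mu_N}(z)-\delta\,\bigr]=0 .$$ -/

import Mathlib

open MeasureTheory ProbabilityTheory Filter Topology Asymptotics
open scoped ENNReal

noncomputable section

/-- The `d × d` Jordan block with eigenvalue `c`: `c` on the diagonal, `1` on the superdiagonal. -/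
def jordanBlock (d : ℕ) (c : ℂ) : Matrix (Fin d) (Fin d) ℂ :=
  Matrix.of fun i j => if i = j then c else if (i : ℕ) + 1 = (j : ℕ) then 1 else 0

/-- The `N × N` block diagonal matrix with Jordan blocks `B¹, …, B^ℓ` in this order; the dimensions
of the blocks (positive integers with sum `N`) are the parts of the composition `b` of `N`, so
`ℓ = b.length`, and `c i` is the eigenvalue of the `i`-th block. -/
def jordanMatrix {N : ℕ} (b : Composition N) (c : Fin b.length → ℂ) :
    Matrix (Fin N) (Fin N) ℂ :=
  Matrix.reindex b.blocksFinEquiv b.blocksFinEquiv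
    (Matrix.blockDiagonal' fun i => jordanBlock (b.blocksFun i) (c i))

/-- The numbers `a_i`, for which the `i`-th block has dimension `a_i log N`. -/
def blockRatio {N : ℕ} (b : Composition N) (i : Fin b.length) : ℝ :=
  (b.blocksFun i : ℝ) / Real.log N

/-- The radii `r_i = exp ((-γ + 1/2) / a_i)`. -/
def blockRadius {N : ℕ} (γ : ℝ) (b : Composition N) (i : Fin b.length) : ℝ :=
  Real.exp ((-γ + 1 / 2) / blockRatio b i)

/-- The uniform probability measure `m_{c,r}` on the circle with centre `c` and radius `r`. -/
def uniformCircle (c : ℂ) (r : ℝ) : Measure ℂ :=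
  Measure.map (circleMap c r)
    ((ENNReal.ofReal (2 * Real.pi))⁻¹ • volume.restrict (Set.Ioc 0 (2 * Real.pi)))

/-- The measure `μ_N = ∑ i, (a_i log N / N) m_{c_i, r_i}`. -/
def circleMixture {N : ℕ} (γ : ℝ) (b : Composition N) (c : Fin b.length → ℂ) : Measure ℂ :=
  ∑ i, ((b.blocksFun i : ℝ≥0∞) / (N : ℝ≥0∞)) • uniformCircle (c i) (blockRadius γ b i)

/-- The empirical spectral measure of an `N × N` matrix (eigenvalues with multiplicity). -/
def empiricalSpectralMeasure {N : ℕ} (A : Matrix (Fin N) (Fin N) ℂ) : Measure ℂ :=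
  (N : ℝ≥0∞)⁻¹ • (A.charpoly.roots.map fun w => Measure.dirac w).sum

/-- The logarithmic potential `U_ρ(z) = ∫ log |z - x| dρ(x)`, as an extended real number: the
integral of the positive part minus the integral of the negative part, with `log 0 = -∞`. -/
def logPotential (ρ : Measure ℂ) (z : ℂ) : EReal :=
  ((∫⁻ x, (ENNReal.log ‖z - x‖ₑ).toENNReal ∂ρ : ℝ≥0∞) : EReal) -
    ((∫⁻ x, (-ENNReal.log ‖z - x‖ₑ).toENNReal ∂ρ : ℝ≥0∞) : EReal)

/-- The set `𝒱_N(ε)` of all `z` with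
`min (a_i log N, |1 - |z - c_i|²|⁻¹) < N ^ (2γ - 1 - ε)` for every block `i`. The inverse is
taken in `[0, ∞]`, so it is `∞` if `|z - c_i| = 1`. -/
def stableSet {N : ℕ} (γ ε : ℝ) (b : Composition N) (c : Fin b.length → ℂ) : Set ℂ :=
  {z | ∀ i, min (b.blocksFun i : ℝ≥0∞) (ENNReal.ofReal |1 - ‖z - c i‖ ^ 2|)⁻¹ <
    ENNReal.ofReal ((N : ℝ) ^ (2 * γ - 1 - ε))}

/-- The perturbed matrix `M + N^{-γ} G`, for a real noise matrix `G`. -/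
def perturbedMatrix {N : ℕ} (γ : ℝ) (M : Matrix (Fin N) (Fin N) ℂ)
    (G : Matrix (Fin N) (Fin N) ℝ) : Matrix (Fin N) (Fin N) ℂ :=
  M + (((N : ℝ) ^ (-γ) : ℝ) : ℂ) • G.map Complex.ofReal

/-- `G` is a random matrix whose entries are i.i.d. (real) standard normal variables. -/
def IsStandardGaussianMatrix {Ω : Type*} [MeasurableSpace Ω] (P : Measure Ω) {N : ℕ}
    (G : Ω → Matrix (Fin N) (Fin N) ℝ) : Prop :=
  iIndepFun (fun (p : Fin N × Fin N) ω => G ω p.1 p.2) P ∧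
    ∀ i j, HasLaw (fun ω => G ω i j) (gaussianReal 0 1) P

end

/-! Write `σ = N ^ (-γ)`, `τ = N ^ (1/2 - γ) = σ √N`, `n_i` for the block sizes and `w_i = c_i - z`.
Off the spectrum `N * U_{L_N}(z)` is the logarithm of `|det (M + σ G - z)|`, while Jensen's formula
on each circle bounds `N * U_{μ_N}(z)` by `∑ log (max τ (|w_i| ^ n_i))`. It is therefore enough
that, with probability tending to one, the determinant exceeds `exp (-δ N) * ∏ max τ (|w_i| ^ n_i)`.

A block with `|w| < 1` and `|w| ^ n < n τ` has a singular value hidden by the noise. Deleting its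
first column and last row leaves a block of determinant `1`. Altogether `s ≤ ℓ = o(N)` rows and
columns disappear. Let `D` be the remaining submatrix of `M - z`, divided by `σ`, and `X = D⁻¹`.
Membership in `𝒱_N` bounds the squared Frobenius norm of `X` by `T = N ^ (-ε) + ℓ / N`, which tends
to `0` (`exists_truncatedBlock_mul_eq_one`).

Two probabilistic estimates follow. For the part `G'` of the noise facing `D`, the variable `det ((D
+ G') X) - 1` has second moment `O(T)`: expand in the rows and bound every coefficient by a weighted
Hadamard inequality (`sum_option_norm_det_sub_sq_le`). Hence `|det (D + G')| ≥ |det D| / 2` with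
high probability. Given these rows, the full determinant is multilinear in the `s` remaining
Gaussian rows, and its squared coefficients add up to at least `s!` times the squared minor.
Integrating a negative moment row by row (`lintegral_multilinear_rpow_le`) shows that it falls below
`θ √s! |minor|` with probability at most `6 ^ s √θ`.

With `θ = exp (-δ N / 2)` this probability vanishes because `s = o(N)`. What remains is
deterministic: the product of the maxima exceeds the main term by at most `exp (δ N / 2) / 2`
(`exp_mul_prod_max_le`). -/

/-! ### Positive and negative moments of affine functions of a Gaussian vector. -/

/-- The standard Gaussian measure on `ι → ℝ`. -/
noncomputable abbrev stdGaussianPi (ι : Type*) [Fintype ι] : Measure (ι → ℝ) :=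
  Measure.pi fun _ => gaussianReal 0 1

lemma stdGaussianPi_map_sum_mul {ι : Type*} [Fintype ι] (a : ι → ℝ) :
    (stdGaussianPi ι).map (fun g => ∑ i, a i * g i) =
      gaussianReal 0 (∑ i, a i ^ 2).toNNReal := by
  have hind : iIndepFun (fun i (g : ι → ℝ) => a i * g i) (stdGaussianPi ι) :=
    iIndepFun_pi (X := fun i x => a i * x) (fun i => by fun_prop)
  have hm : ∀ i, Measurable (fun g : ι → ℝ => a i * g i) := fun i => by fun_prop
  have hev : ∀ i, (stdGaussianPi ι).map (fun g => g i) = gaussianReal 0 1 := fun i =>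
    (measurePreserving_eval (fun _ : ι => gaussianReal 0 1) i).map_eq
  have hlaw : ∀ i, (stdGaussianPi ι).map (fun g => a i * g i) =
      gaussianReal 0 (.mk (a i ^ 2) (sq_nonneg _)) := by
    intro i
    have := gaussianReal_map_const_mul (μ := 0) (v := 1) (a i)
    rw [← hev i, Measure.map_map (by fun_prop) (by fun_prop)] at this
    simpa [Function.comp_def] using this
  have hG : ∀ i, HasGaussianLaw (fun g : ι → ℝ => a i * g i) (stdGaussianPi ι) := fun i =>
    ⟨by rw [hlaw i]; infer_instance⟩
  have hsum := iIndepFun.hasGaussianLaw_fun_sum hG hind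
  rw [hsum.map_eq_gaussianReal]
  have hmean : ∀ i, ∫ g, a i * g i ∂(stdGaussianPi ι) = 0 := by
    intro i
    have h1 : ∫ x, x ∂((stdGaussianPi ι).map (fun g => a i * g i)) =
      ∫ g, a i * g i ∂(stdGaussianPi ι) := integral_map (hm i).aemeasurable (by fun_prop)
    rw [← h1, hlaw i, integral_id_gaussianReal]
  congr 1
  · rw [integral_finsetSum]
    · simp [hmean]
    · intro i _
      exact (hG i).integrable
  · congr 1
    have h := variance_sum_pi (μ := fun _ : ι => gaussianReal 0 1) (X := fun i x => a i * x)
      (fun i => (memLp_id_gaussianReal 2).const_mul (a i))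
    have h' : ∀ i, Var[fun x => a i * x; gaussianReal 0 1] = a i ^ 2 := by
      intro i
      rw [variance_const_mul, variance_fun_id_gaussianReal]
      simp
    simp_rw [h'] at h
    rw [← h]
    congr 1
    ext g
    simp

lemma lintegral_sq_add_gaussianReal (y : ℝ) (v : NNReal) :
    ∫⁻ x, ENNReal.ofReal ((y + x) ^ 2) ∂(gaussianReal 0 v) = ENNReal.ofReal (y ^ 2 + v) := by
  have hm : MemLp (fun x : ℝ => x) 2 (gaussianReal 0 v) := memLp_id_gaussianReal 2
  have h1 : Integrable (fun x : ℝ => x) (gaussianReal 0 v) := hm.integrable (by simp)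
  have h2 : Integrable (fun x : ℝ => x ^ 2) (gaussianReal 0 v) := hm.integrable_sq
  have hv : ∫ x, x ^ 2 ∂(gaussianReal 0 v) = v := by
    have := variance_eq_sub hm
    rw [variance_fun_id_gaussianReal, integral_id_gaussianReal] at this
    simpa using this.symm
  have he : (fun x : ℝ => (y + x) ^ 2) = fun x => (y ^ 2 + 2 * y * x) + x ^ 2 := by
    ext x; ring
  have h3 : Integrable (fun x : ℝ => 2 * y * x) (gaussianReal 0 v) := h1.const_mul _
  have h4 : Integrable (fun x : ℝ => y ^ 2 + 2 * y * x) (gaussianReal 0 v) :=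
    (integrable_const _).add h3
  rw [← ofReal_integral_eq_lintegral_ofReal]
  · rw [he, integral_add h4 h2, integral_add (integrable_const _) h3,
      integral_const_mul, integral_id_gaussianReal, hv]
    simp
  · rw [he]; exact h4.add h2
  · exact ae_of_all _ fun x => sq_nonneg _

lemma lintegral_sq_add_sum_mul {ι : Type*} [Fintype ι] (y : ℝ) (a : ι → ℝ) :
    ∫⁻ g, ENNReal.ofReal ((y + ∑ i, a i * g i) ^ 2) ∂(stdGaussianPi ι) =
      ENNReal.ofReal (y ^ 2 + ∑ i, a i ^ 2) := by
  have := lintegral_sq_add_gaussianReal y (∑ i, a i ^ 2).toNNReal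
  rw [← stdGaussianPi_map_sum_mul, lintegral_map (by fun_prop) (by fun_prop)] at this
  rw [this, Real.coe_toNNReal _ (Finset.sum_nonneg fun i _ => sq_nonneg _)]

lemma enorm_sq_eq_ofReal_re_im (w : ℂ) :
    ‖w‖ₑ ^ 2 = ENNReal.ofReal (w.re ^ 2) + ENNReal.ofReal (w.im ^ 2) := by
  rw [← ENNReal.ofReal_add (sq_nonneg _) (sq_nonneg _), ← ofReal_norm,
    ← ENNReal.ofReal_pow (norm_nonneg _), Complex.sq_norm, Complex.normSq_apply]
  ring_nf

/-- The coefficients are complex but the noise is real, so the real and imaginary parts are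
correlated. Only the sum of their second moments enters, and each part is a shifted centred
Gaussian. -/
lemma lintegral_enorm_sq_add_sum_mul {ι : Type*} [Fintype ι] (y : ℂ) (a : ι → ℂ) :
    ∫⁻ g, ‖y + ∑ i, a i * (g i : ℂ)‖ₑ ^ 2 ∂(stdGaussianPi ι) =
      ‖y‖ₑ ^ 2 + ∑ i, ‖a i‖ₑ ^ 2 := by
  have hre : ∀ g : ι → ℝ, (y + ∑ i, a i * (g i : ℂ)).re = y.re + ∑ i, (a i).re * g i := by
    intro g; simp
  have him : ∀ g : ι → ℝ, (y + ∑ i, a i * (g i : ℂ)).im = y.im + ∑ i, (a i).im * g i := by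
    intro g; simp
  simp_rw [enorm_sq_eq_ofReal_re_im, hre, him]
  rw [lintegral_add_left (by fun_prop), lintegral_sq_add_sum_mul, lintegral_sq_add_sum_mul,
    ENNReal.ofReal_add (sq_nonneg _) (Finset.sum_nonneg fun i _ => sq_nonneg _),
    ENNReal.ofReal_add (sq_nonneg _) (Finset.sum_nonneg fun i _ => sq_nonneg _),
    ENNReal.ofReal_sum_of_nonneg (fun i _ => sq_nonneg _),
    ENNReal.ofReal_sum_of_nonneg (fun i _ => sq_nonneg _), Finset.sum_add_distrib]
  ring

lemma ENNReal.rpow_le_rpow_neg {x y : ℝ≥0∞} {p : ℝ} (hp : 0 ≤ p) (h : x ≤ y) :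
    y ^ (-p) ≤ x ^ (-p) := by
  rw [ENNReal.rpow_neg, ENNReal.rpow_neg, ENNReal.inv_le_inv]
  exact ENNReal.rpow_le_rpow h hp

lemma setLIntegral_Ioc_enorm_rpow_neg_half {ρ : ℝ} (hρ : 0 < ρ) :
    ∫⁻ x in Set.Ioc 0 ρ, ‖x‖ₑ ^ (-(1 / 2) : ℝ) = ENNReal.ofReal (2 * ρ ^ (1 / 2 : ℝ)) := by
  have h1 : ∫ x in (0 : ℝ)..ρ, x ^ (-(1 / 2) : ℝ) = 2 * ρ ^ (1 / 2 : ℝ) := by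
    rw [integral_rpow (by norm_num)]
    norm_num
    ring
  rw [← h1, intervalIntegral.integral_of_le hρ.le, ofReal_integral_eq_lintegral_ofReal]
  · refine setLIntegral_congr_fun measurableSet_Ioc fun x hx => ?_
    rw [Real.enorm_eq_ofReal hx.1.le, ENNReal.ofReal_rpow_of_pos hx.1]
  · exact (intervalIntegrable_iff_integrableOn_Ioc_of_le hρ.le).1
      (intervalIntegral.intervalIntegrable_rpow' (by norm_num))
  · exact (ae_restrict_iff' measurableSet_Ioc).2 (ae_of_all _ fun x hx => Real.rpow_nonneg hx.1.le _)

lemma setLIntegral_Ioo_enorm_rpow_neg_half_le {ρ : ℝ} (hρ : 0 < ρ) :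
    ∫⁻ x in Set.Ioo (-ρ) ρ, ‖x‖ₑ ^ (-(1 / 2) : ℝ) ≤ ENNReal.ofReal (4 * ρ ^ (1 / 2 : ℝ)) := by
  have hneg : ∫⁻ x in Set.Ico (-ρ) 0, ‖x‖ₑ ^ (-(1 / 2) : ℝ) =
      ∫⁻ x in Set.Ioc 0 ρ, ‖x‖ₑ ^ (-(1 / 2) : ℝ) := by
    have := (Measure.measurePreserving_neg (volume : Measure ℝ)).setLIntegral_comp_preimage_emb
      (MeasurableEquiv.neg ℝ).measurableEmbedding (fun x => ‖x‖ₑ ^ (-(1 / 2) : ℝ)) (Set.Ioc 0 ρ)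
    simpa using this
  calc ∫⁻ x in Set.Ioo (-ρ) ρ, ‖x‖ₑ ^ (-(1 / 2) : ℝ)
      ≤ ∫⁻ x in (Set.Ico (-ρ) 0 ∪ {0}) ∪ Set.Ioc 0 ρ, ‖x‖ₑ ^ (-(1 / 2) : ℝ) := by
        refine lintegral_mono_set fun x hx => ?_
        rcases lt_trichotomy x 0 with h | h | h
        · exact Or.inl (Or.inl ⟨hx.1.le, h⟩)
        · exact Or.inl (Or.inr h)
        · exact Or.inr ⟨h, hx.2.le⟩
    _ ≤ ((∫⁻ x in Set.Ico (-ρ) 0, ‖x‖ₑ ^ (-(1 / 2) : ℝ)) + ∫⁻ x in {(0 : ℝ)}, ‖x‖ₑ ^ (-(1 / 2) : ℝ)) +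
        ∫⁻ x in Set.Ioc 0 ρ, ‖x‖ₑ ^ (-(1 / 2) : ℝ) :=
        (lintegral_union_le _ _ _).trans (add_le_add_left (lintegral_union_le _ _ _) _)
    _ = _ := by
        rw [hneg, setLIntegral_measure_zero {(0 : ℝ)} _ (by simp), add_zero,
          setLIntegral_Ioc_enorm_rpow_neg_half hρ, ← ENNReal.ofReal_add (by positivity) (by positivity)]
        ring_nf

lemma gaussianPDF_le (v : NNReal) (x : ℝ) :
    gaussianPDF 0 v x ≤ ENNReal.ofReal (√(2 * Real.pi * v))⁻¹ := by
  refine ENNReal.ofReal_le_ofReal ?_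
  rw [gaussianPDFReal]
  refine mul_le_of_le_one_right (by positivity) ?_
  rw [Real.exp_le_one_iff, neg_div]
  exact neg_nonpos.2 (by positivity)

/-- A bounded density integrates `|x| ^ (-1/2)` near its singularity, uniformly in the shift. Where
`|y + x| ≥ √v` the integrand is at most `v ^ (-1/4)`; elsewhere the density bound `(2 π v) ^ (-1/2)`
times `4 v ^ (1/4)` is at most `2 v ^ (-1/4)`. -/
lemma lintegral_enorm_add_rpow_neg_half_gaussianReal_le (y : ℝ) {v : NNReal} (hv : v ≠ 0) :
    ∫⁻ x, ‖y + x‖ₑ ^ (-(1 / 2) : ℝ) ∂(gaussianReal 0 v) ≤ 3 * (v : ℝ≥0∞) ^ (-(1 / 4) : ℝ) := by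
  have hv0 : (0 : ℝ) < v := by positivity
  set ρ : ℝ := √v with hρd
  have hρ : 0 < ρ := Real.sqrt_pos.2 hv0
  have hρv : ENNReal.ofReal ρ ^ (-(1 / 2) : ℝ) = (v : ℝ≥0∞) ^ (-(1 / 4) : ℝ) := by
    rw [hρd, Real.sqrt_eq_rpow, ← ENNReal.ofReal_rpow_of_pos hv0, ← ENNReal.rpow_mul,
      ENNReal.ofReal_coe_nnreal]
    norm_num
  set F : ℝ → ℝ≥0∞ := (Set.Ioo (-ρ) ρ).indicator fun x => ‖x‖ₑ ^ (-(1 / 2) : ℝ) with hF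
  have hFm : Measurable F := by
    refine Measurable.indicator ?_ measurableSet_Ioo
    fun_prop
  have hpt : ∀ x : ℝ, ‖y + x‖ₑ ^ (-(1 / 2) : ℝ) ≤ (v : ℝ≥0∞) ^ (-(1 / 4) : ℝ) + F (y + x) := by
    intro x
    by_cases hx : y + x ∈ Set.Ioo (-ρ) ρ
    · rw [hF, Set.indicator_of_mem hx]
      exact le_add_self
    · refine le_add_right ?_
      rw [← hρv]
      refine ENNReal.rpow_le_rpow_neg (by norm_num) ?_
      rw [← ofReal_norm, Real.norm_eq_abs]
      refine ENNReal.ofReal_le_ofReal ?_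
      by_contra h
      exact hx (abs_lt.1 (not_le.1 h))
  have hI : ∫⁻ x, F (y + x) ∂(gaussianReal 0 v) ≤ 2 * (v : ℝ≥0∞) ^ (-(1 / 4) : ℝ) := by
    rw [gaussianReal_of_var_ne_zero _ hv,
      lintegral_withDensity_eq_lintegral_mul _ (measurable_gaussianPDF 0 v) (by fun_prop)]
    calc ∫⁻ x, (gaussianPDF 0 v * fun x => F (y + x)) x
        ≤ ∫⁻ x, ENNReal.ofReal (√(2 * Real.pi * v))⁻¹ * F (y + x) :=
          lintegral_mono fun x => mul_le_mul_left (gaussianPDF_le v x) _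
      _ = ENNReal.ofReal (√(2 * Real.pi * v))⁻¹ * ∫⁻ x, F x := by
          rw [lintegral_const_mul _ (by fun_prop), lintegral_add_left_eq_self]
      _ ≤ ENNReal.ofReal (√(2 * Real.pi * v))⁻¹ * ENNReal.ofReal (4 * ρ ^ (1 / 2 : ℝ)) := by
          gcongr
          rw [hF, lintegral_indicator measurableSet_Ioo]
          exact setLIntegral_Ioo_enorm_rpow_neg_half_le hρ
      _ ≤ ENNReal.ofReal (2 * ρ ^ (-(1 / 2) : ℝ)) := by
          rw [← ENNReal.ofReal_mul (by positivity)]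
          refine ENNReal.ofReal_le_ofReal ?_
          have h2 : 2 * ρ ≤ √(2 * Real.pi * v) := by
            rw [Real.le_sqrt (by positivity) (by positivity), mul_pow, hρd, Real.sq_sqrt hv0.le]
            nlinarith [Real.pi_gt_three]
          have h3 : ρ ^ (1 / 2 : ℝ) = ρ * ρ ^ (-(1 / 2) : ℝ) := by
            nth_rewrite 2 [← Real.rpow_one ρ]
            rw [← Real.rpow_add hρ]
            norm_num
          rw [inv_mul_le_iff₀ (by positivity), h3]
          have := mul_le_mul_of_nonneg_right h2 (by positivity : 0 ≤ 2 * ρ ^ (-(1 / 2) : ℝ))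
          linarith
      _ = _ := by
          rw [ENNReal.ofReal_mul (by norm_num), ← ENNReal.ofReal_rpow_of_pos hρ, hρv]
          norm_num
  calc ∫⁻ x, ‖y + x‖ₑ ^ (-(1 / 2) : ℝ) ∂(gaussianReal 0 v)
      ≤ ∫⁻ x, ((v : ℝ≥0∞) ^ (-(1 / 4) : ℝ) + F (y + x)) ∂(gaussianReal 0 v) := lintegral_mono hpt
    _ = (v : ℝ≥0∞) ^ (-(1 / 4) : ℝ) + ∫⁻ x, F (y + x) ∂(gaussianReal 0 v) := by
        rw [lintegral_add_left (by fun_prop)]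
        simp
    _ ≤ (v : ℝ≥0∞) ^ (-(1 / 4) : ℝ) + 2 * (v : ℝ≥0∞) ^ (-(1 / 4) : ℝ) := by gcongr
    _ = _ := by ring

lemma lintegral_enorm_add_sum_mul_rpow_neg_half_le {ι : Type*} [Fintype ι] (y : ℝ) (a : ι → ℝ)
    (ha : 0 < ∑ i, a i ^ 2) :
    ∫⁻ g, ‖y + ∑ i, a i * g i‖ₑ ^ (-(1 / 2) : ℝ) ∂(stdGaussianPi ι) ≤
      3 * ENNReal.ofReal (∑ i, a i ^ 2) ^ (-(1 / 4) : ℝ) := by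
  have := lintegral_enorm_add_rpow_neg_half_gaussianReal_le y (v := (∑ i, a i ^ 2).toNNReal)
    (by simpa using ha)
  rwa [← stdGaussianPi_map_sum_mul, lintegral_map (by fun_prop) (by fun_prop)] at this

/-- Negative moment of order `1/2` of a complex affine function of a standard Gaussian vector. -/
lemma lintegral_enorm_sq_add_sum_mul_rpow_le {ι : Type*} [Fintype ι] (y : ℂ) (a : ι → ℂ) :
    ∫⁻ g, (‖y + ∑ i, a i * (g i : ℂ)‖ₑ ^ 2) ^ (-(1 / 4) : ℝ) ∂(stdGaussianPi ι) ≤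
      6 * (∑ i, ‖a i‖ₑ ^ 2) ^ (-(1 / 4) : ℝ) := by
  have hsum : ∑ i, ‖a i‖ₑ ^ 2 =
      ENNReal.ofReal (∑ i, (a i).re ^ 2) + ENNReal.ofReal (∑ i, (a i).im ^ 2) := by
    simp_rw [enorm_sq_eq_ofReal_re_im]
    rw [Finset.sum_add_distrib, ENNReal.ofReal_sum_of_nonneg (fun i _ => sq_nonneg _),
      ENNReal.ofReal_sum_of_nonneg (fun i _ => sq_nonneg _)]
  -- `key` is used for whichever of the real and imaginary parts has the larger variance, hence at
  -- least half of the total. The loss `2 ^ (1/4) ≤ 2` turns the constant `3` into `6`.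
  have key : ∀ (x : ℝ) (u : ι → ℝ),
      (∀ g : ι → ℝ, ‖x + ∑ i, u i * g i‖ₑ ≤ ‖y + ∑ i, a i * (g i : ℂ)‖ₑ) →
      ∑ i, ‖a i‖ₑ ^ 2 ≤ 2 * ENNReal.ofReal (∑ i, u i ^ 2) →
      ∫⁻ g, (‖y + ∑ i, a i * (g i : ℂ)‖ₑ ^ 2) ^ (-(1 / 4) : ℝ) ∂(stdGaussianPi ι) ≤
      6 * (∑ i, ‖a i‖ₑ ^ 2) ^ (-(1 / 4) : ℝ) := by
    intro x u h1 h2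
    rcases eq_or_lt_of_le (Finset.sum_nonneg fun i (_ : i ∈ Finset.univ) => sq_nonneg (u i))
      with h0 | h0
    · rw [← h0] at h2
      have : ∑ i, ‖a i‖ₑ ^ 2 = 0 := by simpa using h2
      rw [this, ENNReal.zero_rpow_of_neg (by norm_num)]
      simp
    · calc ∫⁻ g, (‖y + ∑ i, a i * (g i : ℂ)‖ₑ ^ 2) ^ (-(1 / 4) : ℝ) ∂(stdGaussianPi ι)
          ≤ ∫⁻ g, ‖x + ∑ i, u i * g i‖ₑ ^ (-(1 / 2) : ℝ) ∂(stdGaussianPi ι) := by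
            refine lintegral_mono fun g => ?_
            rw [← ENNReal.rpow_natCast, ← ENNReal.rpow_mul]
            norm_num only
            exact ENNReal.rpow_le_rpow_neg (by norm_num) (h1 g)
        _ ≤ 3 * ENNReal.ofReal (∑ i, u i ^ 2) ^ (-(1 / 4) : ℝ) :=
            lintegral_enorm_add_sum_mul_rpow_neg_half_le x u h0
        _ ≤ 3 * (2 * (∑ i, ‖a i‖ₑ ^ 2) ^ (-(1 / 4) : ℝ)) := by
            gcongr
            calc ENNReal.ofReal (∑ i, u i ^ 2) ^ (-(1 / 4) : ℝ)
                ≤ ((∑ i, ‖a i‖ₑ ^ 2) / 2) ^ (-(1 / 4) : ℝ) :=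
                  ENNReal.rpow_le_rpow_neg (by norm_num) (ENNReal.div_le_of_le_mul' h2)
              _ = (∑ i, ‖a i‖ₑ ^ 2) ^ (-(1 / 4) : ℝ) * 2 ^ (1 / 4 : ℝ) := by
                  rw [div_eq_mul_inv, ENNReal.mul_rpow_of_ne_top _ (by simp), ENNReal.inv_rpow,
                    ← ENNReal.rpow_neg]
                  · norm_num
                  · simp [ENNReal.sum_eq_top]
              _ ≤ (∑ i, ‖a i‖ₑ ^ 2) ^ (-(1 / 4) : ℝ) * 2 := by
                  gcongr
                  nth_rewrite 2 [← ENNReal.rpow_one 2]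
                  exact ENNReal.rpow_le_rpow_of_exponent_le (by norm_num) (by norm_num)
              _ = _ := mul_comm _ _
        _ = _ := by rw [← mul_assoc]; norm_num
  rcases le_total (ENNReal.ofReal (∑ i, (a i).re ^ 2)) (ENNReal.ofReal (∑ i, (a i).im ^ 2))
    with h | h
  · refine key y.im (fun i => (a i).im) (fun g => ?_) ?_
    · have him : (y + ∑ i, a i * (g i : ℂ)).im = y.im + ∑ i, (a i).im * g i := by simp
      rw [← him, ← ofReal_norm, ← ofReal_norm]
      exact ENNReal.ofReal_le_ofReal (Complex.abs_im_le_norm _)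
    · rw [hsum, two_mul]; gcongr
  · refine key y.re (fun i => (a i).re) (fun g => ?_) ?_
    · have hre : (y + ∑ i, a i * (g i : ℂ)).re = y.re + ∑ i, (a i).re * g i := by simp
      rw [← hre, ← ofReal_norm, ← ofReal_norm]
      exact ENNReal.ofReal_le_ofReal (Complex.abs_re_le_norm _)
    · rw [hsum, two_mul]; gcongr

/-- Jensen's inequality for `x ↦ x ^ (-1/4)` on `[0, ∞]`. -/
lemma ENNReal.rpow_neg_quarter_sum_le {R : Type*} [Fintype R] (p Y : R → ℝ≥0∞)
    (hp : ∑ r, p r = 1) :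
    (∑ r, p r * Y r) ^ (-(1 / 4) : ℝ) ≤ ∑ r, p r * Y r ^ (-(1 / 4) : ℝ) := by
  have hptop : ∀ r, p r ≠ ⊤ := fun r h => by
    have : p r ≤ 1 := hp ▸ Finset.single_le_sum (fun i _ => zero_le) (Finset.mem_univ r)
    simp [h] at this
  by_cases h0 : ∃ r, p r ≠ 0 ∧ Y r = 0
  · obtain ⟨r, hr, hY⟩ := h0
    have : ∑ r, p r * Y r ^ (-(1 / 4) : ℝ) = ⊤ := by
      rw [ENNReal.sum_eq_top]
      refine ⟨r, Finset.mem_univ r, ?_⟩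
      rw [hY, ENNReal.zero_rpow_of_neg (by norm_num), ENNReal.mul_top hr]
    rw [this]
    exact le_top
  by_cases h1 : ∃ r, p r ≠ 0 ∧ Y r = ⊤
  · obtain ⟨r, hr, hY⟩ := h1
    have : ∑ r, p r * Y r = ⊤ := by
      rw [ENNReal.sum_eq_top]
      exact ⟨r, Finset.mem_univ r, by rw [hY, ENNReal.mul_top hr]⟩
    rw [this, ENNReal.top_rpow_of_neg (by norm_num)]
    exact zero_le
  push Not at h0 h1
  -- Hölder with exponents `5` and `5/4` applied to `p = (p Y) ^ (1/5) * (p Y ^ (-1/4)) ^ (4/5)`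
  -- gives `1 ≤ A ^ (1/5) * B ^ (4/5)`, which is Jensen's inequality after raising to the power
  -- `5/4`.
  have hhold := ENNReal.inner_le_Lp_mul_Lq Finset.univ
    (fun r => (p r * Y r) ^ (1 / 5 : ℝ)) (fun r => (p r * Y r ^ (-(1 / 4) : ℝ)) ^ (4 / 5 : ℝ))
    (p := 5) (q := 5 / 4) (Real.holderConjugate_iff.2 ⟨by norm_num, by norm_num⟩)
  have hmul : ∀ r, (p r * Y r) ^ (1 / 5 : ℝ) * (p r * Y r ^ (-(1 / 4) : ℝ)) ^ (4 / 5 : ℝ) = p r := by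
    intro r
    by_cases hr : p r = 0
    · simp [hr]
    rw [ENNReal.mul_rpow_of_nonneg _ _ (by norm_num), ENNReal.mul_rpow_of_nonneg _ _ (by norm_num),
      ← ENNReal.rpow_mul, mul_mul_mul_comm, ← ENNReal.rpow_add _ _ hr (hptop r),
      ← ENNReal.rpow_add _ _ (h0 r hr) (h1 r hr)]
    norm_num
  have hp1 : ∀ r, ((p r * Y r) ^ (1 / 5 : ℝ)) ^ (5 : ℝ) = p r * Y r := fun r => by
    rw [← ENNReal.rpow_mul]; norm_num
  have hp2 : ∀ r, ((p r * Y r ^ (-(1 / 4) : ℝ)) ^ (4 / 5 : ℝ)) ^ (5 / 4 : ℝ) =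
      p r * Y r ^ (-(1 / 4) : ℝ) := fun r => by
    rw [← ENNReal.rpow_mul]; norm_num
  simp only [hmul, hp1, hp2, hp] at hhold
  set A := ∑ r, p r * Y r
  set B := ∑ r, p r * Y r ^ (-(1 / 4) : ℝ)
  have h2 : 1 ≤ A ^ (1 / 4 : ℝ) * B := by
    have := ENNReal.rpow_le_rpow hhold (by norm_num : (0 : ℝ) ≤ 5 / 4)
    rw [ENNReal.one_rpow, ENNReal.mul_rpow_of_nonneg _ _ (by norm_num), ← ENNReal.rpow_mul,
      ← ENNReal.rpow_mul] at this
    norm_num at this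
    norm_num
    exact this
  rw [ENNReal.rpow_neg]
  rw [← one_div]
  exact ENNReal.div_le_of_le_mul (by rwa [mul_comm])

/-- Negative moments of the norm of an affine vector-valued function of a Gaussian vector. -/
lemma lintegral_sum_enorm_sq_rpow_le {ι R : Type*} [Fintype ι] [Fintype R] (y : R → ℂ)
    (a : R → ι → ℂ) :
    ∫⁻ g, (∑ r, ‖y r + ∑ i, a r i * (g i : ℂ)‖ₑ ^ 2) ^ (-(1 / 4) : ℝ) ∂(stdGaussianPi ι) ≤
      6 * (∑ r, ∑ i, ‖a r i‖ₑ ^ 2) ^ (-(1 / 4) : ℝ) := by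
  set V : R → ℝ≥0∞ := fun r => ∑ i, ‖a r i‖ₑ ^ 2 with hV
  set W : ℝ≥0∞ := ∑ r, V r with hW
  have hVtop : ∀ r, V r ≠ ⊤ := fun r => by simp [hV, ENNReal.sum_eq_top]
  have hWtop : W ≠ ⊤ := by simp [hW, ENNReal.sum_eq_top, hVtop]
  change _ ≤ 6 * W ^ (-(1 / 4) : ℝ)
  by_cases hW0 : W = 0
  · rw [hW0, ENNReal.zero_rpow_of_neg (by norm_num)]
    simp
  set X : R → (ι → ℝ) → ℝ≥0∞ := fun r g => ‖y r + ∑ i, a r i * (g i : ℂ)‖ₑ ^ 2 with hX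
  have hXm : ∀ r, Measurable (X r) := fun r => by fun_prop
  -- Jensen with weights proportional to the variances: every term `X r / p r` then has the same
  -- bound `6 * W ^ (-1/4)`, so the constant does not depend on the number of components.
  set p : R → ℝ≥0∞ := fun r => V r / W with hp
  have hptop : ∀ r, p r ≠ ⊤ := fun r => ENNReal.div_ne_top (hVtop r) hW0
  have hp1 : ∑ r, p r = 1 := by
    simp_rw [hp, div_eq_mul_inv]
    rw [← Finset.sum_mul, ENNReal.mul_inv_cancel hW0 hWtop]
  calc ∫⁻ g, (∑ r, X r g) ^ (-(1 / 4) : ℝ) ∂(stdGaussianPi ι)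
      ≤ ∫⁻ g, ∑ r, p r * (X r g / p r) ^ (-(1 / 4) : ℝ) ∂(stdGaussianPi ι) := by
        refine lintegral_mono fun g => ?_
        refine le_trans ?_ (ENNReal.rpow_neg_quarter_sum_le p _ hp1)
        refine ENNReal.rpow_le_rpow_neg (by norm_num) ?_
        exact Finset.sum_le_sum fun r _ => ENNReal.mul_div_le
    _ = ∑ r, p r * ∫⁻ g, (X r g / p r) ^ (-(1 / 4) : ℝ) ∂(stdGaussianPi ι) := by
        rw [lintegral_finsetSum _ (fun r _ => by fun_prop)]
        refine Finset.sum_congr rfl fun r _ => ?_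
        rw [lintegral_const_mul _ (by fun_prop)]
    _ ≤ ∑ r, p r * (6 * W ^ (-(1 / 4) : ℝ)) := by
        refine Finset.sum_le_sum fun r _ => ?_
        by_cases hr : p r = 0
        · simp [hr]
        have hVr : V r ≠ 0 := fun h => hr (by simp [hp, h])
        gcongr
        have hXtop : ∀ g, X r g ≠ ⊤ := fun g => by simp [hX]
        calc ∫⁻ g, (X r g / p r) ^ (-(1 / 4) : ℝ) ∂(stdGaussianPi ι)
            = ∫⁻ g, p r ^ (1 / 4 : ℝ) * X r g ^ (-(1 / 4) : ℝ) ∂(stdGaussianPi ι) := by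
              refine lintegral_congr fun g => ?_
              rw [div_eq_mul_inv, ENNReal.mul_rpow_of_ne_top (hXtop g) (by simpa using hr),
                ENNReal.inv_rpow, ← ENNReal.rpow_neg, neg_neg, mul_comm]
          _ = p r ^ (1 / 4 : ℝ) * ∫⁻ g, X r g ^ (-(1 / 4) : ℝ) ∂(stdGaussianPi ι) := by
              rw [lintegral_const_mul _ (by fun_prop)]
          _ ≤ p r ^ (1 / 4 : ℝ) * (6 * V r ^ (-(1 / 4) : ℝ)) := by
              gcongr
              exact lintegral_enorm_sq_add_sum_mul_rpow_le (y r) (a r)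
          _ = 6 * W ^ (-(1 / 4) : ℝ) := by
              rw [hp, ENNReal.div_rpow_of_nonneg _ _ (by norm_num), mul_left_comm,
                div_eq_mul_inv, mul_right_comm, ← ENNReal.rpow_add _ _ hVr (hVtop r),
                ← ENNReal.rpow_neg]
              norm_num
    _ = _ := by rw [← Finset.sum_mul, hp1, one_mul]

/-! ### Multilinear functions of independent Gaussian rows. -/

/-- Tonelli's inequality for a product indexed by `Fin (m + 1)`. -/
lemma lintegral_pi_fin_succ_le {α : Type*} [MeasurableSpace α] (μ : Measure α) [SigmaFinite μ]
    {m : ℕ} (F : (Fin (m + 1) → α) → ℝ≥0∞) :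
    ∫⁻ g, F g ∂(Measure.pi fun _ => μ) ≤
      ∫⁻ h, ∫⁻ x, F (Fin.cons x h) ∂μ ∂(Measure.pi fun _ : Fin m => μ) := by
  have h1 := (measurePreserving_piFinSuccAbove (fun _ : Fin (m + 1) => μ) 0).symm
  have h2 := (h1.comp Measure.measurePreserving_swap).lintegral_comp_emb
    ((MeasurableEquiv.measurableEmbedding _).comp MeasurableEquiv.prodComm.measurableEmbedding) F
  rw [← h2]
  -- Only this direction is needed, so no measurability of `F` is required.
  refine (lintegral_prod_le _).trans (le_of_eq ?_)
  simp [MeasurableEquiv.piFinSuccAbove_symm_apply, Fin.insertNthEquiv]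

/-- The point `b + g` of `(ι → ℂ)^m`, for a real `g`. -/
def realShift {m : ℕ} {ι : Type*} (b : Fin m → ι → ℂ) (g : Fin m → ι → ℝ) : Fin m → ι → ℂ :=
  fun j i => b j i + (g j i : ℂ)

lemma map_cons_realShift {m : ℕ} {ι : Type*} [Fintype ι] [DecidableEq ι]
    (f : MultilinearMap ℂ (fun _ : Fin (m + 1) => ι → ℂ) ℂ) (b : Fin (m + 1) → ι → ℂ)
    (x : ι → ℝ) (h : Fin m → ι → ℝ) :
    f (realShift b (Fin.cons x h)) = f.curryLeft (b 0) (realShift (Fin.tail b) h) +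
      ∑ i, f.curryLeft (Pi.single i 1) (realShift (Fin.tail b) h) * (x i : ℂ) := by
  have h1 : realShift b (Fin.cons x h) =
      Fin.cons (b 0 + ∑ i, (x i : ℂ) • (Pi.single i 1 : ι → ℂ)) (realShift (Fin.tail b) h) := by
    ext j i
    refine Fin.cases ?_ (fun j => ?_) j
    · simp [realShift, Finset.sum_apply, Pi.single_apply]
    · simp [realShift, Fin.tail]
  rw [h1, ← MultilinearMap.curryLeft_apply, map_add, map_sum]
  simp [mul_comm]

/-- Negative moments of multilinear functions of independent shifted Gaussian vectors. -/
lemma lintegral_multilinear_rpow_le {ι : Type} [Fintype ι] [DecidableEq ι] (m : ℕ) :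
    ∀ (R : Type) [Fintype R] (f : R → MultilinearMap ℂ (fun _ : Fin m => ι → ℂ) ℂ)
      (b : Fin m → ι → ℂ),
    ∫⁻ g, (∑ r, ‖f r (realShift b g)‖ₑ ^ 2) ^ (-(1 / 4) : ℝ)
        ∂(Measure.pi fun _ : Fin m => stdGaussianPi ι) ≤
      6 ^ m * (∑ r, ∑ φ : Fin m → ι, ‖f r (fun j => Pi.single (φ j) 1)‖ₑ ^ 2) ^ (-(1 / 4) : ℝ) := by
  induction m with
  | zero =>
    intro R _ f b
    have : ∀ (r : R) (u : Fin 0 → ι → ℂ), f r u = f r 0 := fun r u => by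
      congr 1; exact Subsingleton.elim _ _
    simp [this]
  | succ m ih =>
    -- Integrating out one row replaces the family over `R` by the family of its coefficients over
    -- `R × ι`. The claim is stated for families so that this costs a single factor `6` per row.
    intro R _ f b
    refine (lintegral_pi_fin_succ_le _ _).trans ?_
    have h1 : ∀ h : Fin m → ι → ℝ, ∫⁻ x, (∑ r, ‖f r (realShift b (Fin.cons x h))‖ₑ ^ 2) ^
        (-(1 / 4) : ℝ) ∂(stdGaussianPi ι) ≤ 6 * (∑ q : R × ι,
          ‖(f q.1).curryLeft (Pi.single q.2 1) (realShift (Fin.tail b) h)‖ₑ ^ 2) ^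
            (-(1 / 4) : ℝ) := by
      intro h
      simp_rw [map_cons_realShift]
      refine (lintegral_sum_enorm_sq_rpow_le _ _).trans ?_
      rw [Fintype.sum_prod_type]
    refine (lintegral_mono h1).trans ?_
    rw [lintegral_const_mul' _ _ (by norm_num), pow_succ', mul_assoc]
    gcongr
    refine (ih (R × ι) (fun q => (f q.1).curryLeft (Pi.single q.2 1)) (Fin.tail b)).trans ?_
    refine le_of_eq ?_
    congr 2
    rw [Fintype.sum_prod_type]
    refine Finset.sum_congr rfl fun r _ => ?_
    rw [← (Fin.consEquiv fun _ : Fin (m + 1) => ι).sum_comp, Fintype.sum_prod_type]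
    refine Finset.sum_congr rfl fun i _ => Finset.sum_congr rfl fun φ _ => ?_
    rw [MultilinearMap.curryLeft_apply]
    congr 3
    ext j
    refine Fin.cases ?_ (fun j => ?_) j <;> simp [Fin.consEquiv]

lemma measurable_multilinear_realShift {m : ℕ} {ι : Type*} [Fintype ι]
    (f : MultilinearMap ℂ (fun _ : Fin m => ι → ℂ) ℂ) (b : Fin m → ι → ℂ) :
    Measurable fun g : Fin m → ι → ℝ => f (realShift b g) := by
  classical
  have hf : Continuous f := by
    have he : ∀ v, f v = ∑ φ : Fin m → ι, (∏ j, v j (φ j)) * f fun j => Pi.single (φ j) 1 := by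
      intro v
      have hv : v = fun j => ∑ i, v j i • (Pi.single i 1 : ι → ℂ) := by
        ext j i
        simp [Finset.sum_apply, Pi.single_apply]
      conv_lhs => rw [hv]
      rw [MultilinearMap.map_sum]
      simp [MultilinearMap.map_smul_univ]
    rw [funext he]
    fun_prop
  have hs : Continuous fun g : Fin m → ι → ℝ => realShift b g := by
    unfold realShift
    fun_prop
  exact (hf.comp hs).measurable

/-- Second moments of multilinear functions of independent shifted Gaussian vectors. -/
lemma lintegral_multilinear_sq_le {ι : Type*} [Fintype ι] [DecidableEq ι] (m : ℕ) :
    ∀ (f : MultilinearMap ℂ (fun _ : Fin m => ι → ℂ) ℂ) (b : Fin m → ι → ℂ) (c : ℂ),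
    ∫⁻ g, ‖f (realShift b g) - c‖ₑ ^ 2 ∂(Measure.pi fun _ : Fin m => stdGaussianPi ι) ≤
      ∑ ψ : Fin m → Option ι, ‖f (fun j => (ψ j).elim (b j) fun i => Pi.single i 1) -
        if ψ = (fun _ => none) then c else 0‖ₑ ^ 2 := by
  induction m with
  | zero =>
    intro f b c
    have : ∀ (u : Fin 0 → ι → ℂ), f u = f 0 := fun u => by
      congr 1; exact Subsingleton.elim _ _
    have h2 : ∀ ψ : Fin 0 → Option ι, ψ = fun _ => none := fun ψ => Subsingleton.elim _ _
    simp_rw [this, if_pos (h2 _)]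
    simp
  | succ m ih =>
    intro f b c
    refine (lintegral_pi_fin_succ_le _ _).trans ?_
    have h1 : ∀ h : Fin m → ι → ℝ, ∫⁻ x, ‖f (realShift b (Fin.cons x h)) - c‖ₑ ^ 2
        ∂(stdGaussianPi ι) = ‖f.curryLeft (b 0) (realShift (Fin.tail b) h) - c‖ₑ ^ 2 +
          ∑ i, ‖f.curryLeft (Pi.single i 1) (realShift (Fin.tail b) h) - 0‖ₑ ^ 2 := by
      intro h
      simp_rw [map_cons_realShift, add_sub_right_comm, sub_zero]
      exact lintegral_enorm_sq_add_sum_mul _ _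
    simp_rw [h1]
    rw [lintegral_add_left (((measurable_multilinear_realShift _ _).sub_const c).enorm.pow_const 2),
      lintegral_finsetSum _ fun i _ =>
        ((measurable_multilinear_realShift _ _).sub_const 0).enorm.pow_const 2]
    refine (add_le_add (ih _ _ _) (Finset.sum_le_sum fun i _ => ih _ _ _)).trans ?_
    rw [← (Fin.consEquiv fun _ : Fin (m + 1) => Option ι).sum_comp, Fintype.sum_prod_type,
      Fintype.sum_option]
    refine le_of_eq ?_
    have hcons : ∀ (o : Option ι) (ψ : Fin m → Option ι),
        (fun j => ((Fin.consEquiv fun _ : Fin (m + 1) => Option ι) (o, ψ) j).elim (b j)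
          fun i => (Pi.single i 1 : ι → ℂ)) =
        Fin.cons (o.elim (b 0) fun i => Pi.single i 1)
          (fun j => (ψ j).elim (Fin.tail b j) fun i => Pi.single i 1) := by
      intro o ψ
      ext j
      refine Fin.cases ?_ (fun j => ?_) j <;> simp [Fin.consEquiv, Fin.tail]
    simp_rw [hcons, MultilinearMap.curryLeft_apply]
    congr 1
    · refine Finset.sum_congr rfl fun ψ _ => ?_
      have : ((Fin.consEquiv fun _ : Fin (m + 1) => Option ι) (none, ψ) = fun _ => none) ↔
          ψ = fun _ => none := by
        simp [funext_iff, Fin.forall_fin_succ, Fin.consEquiv]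
      simp only [this, Option.elim_none]
    · refine Finset.sum_congr rfl fun i _ => Finset.sum_congr rfl fun ψ _ => ?_
      have : ¬ ((Fin.consEquiv fun _ : Fin (m + 1) => Option ι) (some i, ψ) = fun _ => none) := by
        simp [funext_iff, Fin.forall_fin_succ, Fin.consEquiv]
      simp [this]

/-! ### Hadamard's inequality and its weighted form. -/

open ComplexOrder in
/-- Hadamard's inequality for matrices whose rows are unit vectors. -/
lemma Matrix.norm_det_sq_le_one {n : Type*} [Fintype n] [DecidableEq n] (M : Matrix n n ℂ)
    (hM : ∀ i, ∑ j, ‖M i j‖ ^ 2 = 1) : ‖M.det‖ ^ 2 ≤ 1 := by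
  have hpsd : (M * M.conjTranspose).PosSemidef := Matrix.posSemidef_self_mul_conjTranspose M
  have hH := hpsd.isHermitian
  have htr : ∑ i, (hH.eigenvalues i) = Fintype.card n := by
    have h1 := hH.trace_eq_sum_eigenvalues
    have h2 : (M * M.conjTranspose).trace = ((Fintype.card n : ℝ) : ℂ) := by
      rw [Matrix.trace]
      simp only [Matrix.diag_apply, Matrix.mul_apply, Matrix.conjTranspose_apply]
      have : ∀ i, ∑ j, M i j * star (M i j) = ((∑ j, ‖M i j‖ ^ 2 : ℝ) : ℂ) := by
        intro i
        push_cast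
        refine Finset.sum_congr rfl fun j _ => ?_
        rw [Complex.star_def, Complex.mul_conj, Complex.normSq_eq_norm_sq]
        push_cast; rfl
      simp_rw [this, hM]
      simp
    rw [h2] at h1
    refine Complex.ofReal_injective ?_
    rw [h1]
    push_cast
    rfl
  have hdet : ((‖M.det‖ ^ 2 : ℝ) : ℂ) = ((∏ i, hH.eigenvalues i : ℝ) : ℂ) := by
    have h1 := hH.det_eq_prod_eigenvalues
    rw [Matrix.det_mul, Matrix.det_conjTranspose, Complex.star_def, Complex.mul_conj,
      Complex.normSq_eq_norm_sq] at h1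
    rw [h1]
    push_cast; rfl
  have hdet' : ‖M.det‖ ^ 2 = ∏ i, hH.eigenvalues i := by exact_mod_cast hdet
  rw [hdet']
  -- Arithmetic-geometric mean inequality in the form `x ≤ exp (x - 1)`: the eigenvalues of the Gram
  -- matrix add up to the number of rows.
  calc ∏ i, hH.eigenvalues i ≤ ∏ i, Real.exp (hH.eigenvalues i - 1) :=
        Finset.prod_le_prod (fun i _ => hpsd.eigenvalues_nonneg i) fun i _ => by
          linarith [Real.add_one_le_exp (hH.eigenvalues i - 1)]
    _ = 1 := by
        rw [← Real.exp_sum, Finset.sum_sub_distrib, htr]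
        simp

/-- **Hadamard's inequality**. -/
lemma Matrix.norm_det_sq_le_prod {n : Type*} [Fintype n] [DecidableEq n] (M : Matrix n n ℂ) :
    ‖M.det‖ ^ 2 ≤ ∏ i, ∑ j, ‖M i j‖ ^ 2 := by
  by_cases h : ∃ i, ∑ j, ‖M i j‖ ^ 2 = 0
  · obtain ⟨i, hi⟩ := h
    have : M.det = 0 := by
      refine Matrix.det_eq_zero_of_row_eq_zero i fun j => ?_
      have := (Finset.sum_eq_zero_iff_of_nonneg (fun j _ => by positivity)).1 hi j
        (Finset.mem_univ j)
      simpa using this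
    rw [this]
    simp only [norm_zero, ne_eq, OfNat.ofNat_ne_zero, not_false_eq_true, zero_pow]
    exact Finset.prod_nonneg fun i _ => Finset.sum_nonneg fun j _ => by positivity
  push Not at h
  have hpos : ∀ i, 0 < ∑ j, ‖M i j‖ ^ 2 := fun i =>
    lt_of_le_of_ne (Finset.sum_nonneg fun j _ => by positivity) (h i).symm
  set d : n → ℝ := fun i => √(∑ j, ‖M i j‖ ^ 2) with hd
  have hdpos : ∀ i, 0 < d i := fun i => Real.sqrt_pos.2 (hpos i)
  have hd2 : ∀ i, d i ^ 2 = ∑ j, ‖M i j‖ ^ 2 := fun i => Real.sq_sqrt (hpos i).le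
  have hM : M = Matrix.of fun i j => (d i : ℂ) *
      (Matrix.of fun i j => ((d i)⁻¹ : ℂ) * M i j : Matrix n n ℂ) i j := by
    ext i j
    have : (d i : ℂ) ≠ 0 := by exact_mod_cast (hdpos i).ne'
    simp [this]
  have h1 := Matrix.norm_det_sq_le_one (Matrix.of fun i j => ((d i)⁻¹ : ℂ) * M i j) (by
    intro i
    simp only [Matrix.of_apply, norm_mul, mul_pow, norm_inv, Complex.norm_real, Real.norm_eq_abs,
      inv_pow, sq_abs]
    rw [← Finset.mul_sum, hd2, inv_mul_cancel₀ (h i)])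
  rw [hM, Matrix.det_mul_column, norm_mul, mul_pow, norm_prod, ← Finset.prod_pow]
  have h2 : ∀ i, ‖(d i : ℂ)‖ ^ 2 = ∑ j, ‖M i j‖ ^ 2 := fun i => by
    rw [Complex.norm_real, Real.norm_eq_abs, sq_abs, hd2]
  rw [← hM]
  simp_rw [h2]
  exact mul_le_of_le_one_right (Finset.prod_nonneg fun i _ => (hpos i).le) h1

/-- Hadamard's inequality with column weights, for matrices with rows of the identity
outside `J`. -/
lemma Matrix.norm_det_sq_le_of_row_eq_one {n : Type*} [Fintype n] [DecidableEq n]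
    (M : Matrix n n ℂ) (J : Finset n) (hJ : ∀ j ∉ J, M j = (1 : Matrix n n ℂ) j)
    (q : n → ℝ) (hq : ∀ k, 0 < q k) :
    ‖M.det‖ ^ 2 ≤ (∏ k ∈ J, (q k)⁻¹) * ∏ j ∈ J, ∑ k, q k * ‖M j k‖ ^ 2 := by
  -- Scaling column `k` by `√(q k)` multiplies the squared determinant by `∏ q k`. An identity row
  -- acquires squared norm `q j`, so the weights outside `J` cancel.
  have h1 := Matrix.norm_det_sq_le_prod (Matrix.of fun i j => ((√(q j) : ℝ) : ℂ) * M i j)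
  rw [Matrix.det_mul_row, norm_mul, mul_pow, norm_prod, ← Finset.prod_pow] at h1
  have h2 : ∀ k, ‖((√(q k) : ℝ) : ℂ)‖ ^ 2 = q k := fun k => by
    rw [Complex.norm_real, Real.norm_eq_abs, sq_abs, Real.sq_sqrt (hq k).le]
  simp only [Matrix.of_apply, norm_mul, mul_pow, h2] at h1
  have h3 : ∏ j, ∑ k, q k * ‖M j k‖ ^ 2 =
      (∏ j ∈ Jᶜ, q j) * ∏ j ∈ J, ∑ k, q k * ‖M j k‖ ^ 2 := by
    rw [← Finset.prod_compl_mul_prod J]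
    congr 1
    refine Finset.prod_congr rfl fun j hj => ?_
    rw [hJ j (by simpa using hj), Finset.sum_eq_single j]
    · simp
    · intro k _ hk
      simp [Matrix.one_apply_ne hk.symm]
    · simp
  rw [h3, ← Finset.prod_compl_mul_prod J q, mul_assoc] at h1
  have h4 := le_of_mul_le_mul_left h1 (Finset.prod_pos fun k _ => hq k)
  rw [Finset.prod_inv_distrib, ← div_eq_inv_mul, le_div_iff₀ (Finset.prod_pos fun k _ => hq k),
    mul_comm]
  exact h4

/-! ### Second moment of the relative perturbation of a determinant. -/

/-- Every squarefree monomial of degree `j` occurs `j!` times in the expanded power, and the other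
terms are nonnegative. The induction on `s` uses just the first two terms of the binomial expansion.
-/
lemma Finset.factorial_mul_sum_powersetCard_prod_le {α : Type*} [DecidableEq α] (t : α → ℝ)
    (ht : ∀ k, 0 ≤ t k) (s : Finset α) :
    ∀ j : ℕ, (j.factorial : ℝ) * ∑ J ∈ s.powersetCard j, ∏ k ∈ J, t k ≤ (∑ k ∈ s, t k) ^ j := by
  induction s using Finset.induction_on with
  | empty =>
    intro j
    cases j with
    | zero => simp
    | succ j => rw [Finset.powersetCard_eq_empty.2 (by simp)]; simp
  | insert a s ha ih =>
    intro j
    have hP : 0 ≤ ∑ k ∈ s, t k := Finset.sum_nonneg fun k _ => ht k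
    cases j with
    | zero => simp
    | succ j =>
      rw [Finset.powersetCard_succ_insert ha, Finset.sum_union, Finset.sum_image]
      · have h1 : ∑ J ∈ s.powersetCard j, ∏ k ∈ insert a J, t k =
            t a * ∑ J ∈ s.powersetCard j, ∏ k ∈ J, t k := by
          rw [Finset.mul_sum]
          refine Finset.sum_congr rfl fun J hJ => ?_
          rw [Finset.prod_insert fun h => ha ((Finset.mem_powersetCard.1 hJ).1 h)]
        rw [h1, Finset.sum_insert ha, mul_add]
        have h2 := ih (j + 1)
        have h3 := mul_le_mul_of_nonneg_left (ih j)
          (mul_nonneg (by positivity : (0 : ℝ) ≤ j + 1) (ht a))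
        have h4 : ((j + 1).factorial : ℝ) * (t a * ∑ J ∈ s.powersetCard j, ∏ k ∈ J, t k) =
            ((j : ℝ) + 1) * t a * ((j.factorial : ℝ) * ∑ J ∈ s.powersetCard j, ∏ k ∈ J, t k) := by
          rw [Nat.factorial_succ]; push_cast; ring
        rw [h4]
        refine (add_le_add h2 h3).trans ?_
        have h5 : ∀ (P x : ℝ) (_ : 0 ≤ P) (_ : 0 ≤ x) (n : ℕ),
            P ^ (n + 1) + ((n : ℝ) + 1) * x * P ^ n ≤ (x + P) ^ (n + 1) := by
          intro P x hP hx n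
          induction n with
          | zero => simp [add_comm]
          | succ n ihn =>
            have := mul_le_mul_of_nonneg_right ihn (add_nonneg hx hP)
            rw [← pow_succ] at this
            refine le_trans ?_ this
            have hx2 : 0 ≤ ((n : ℝ) + 1) * x * P ^ n * x := by positivity
            push_cast
            ring_nf at hx2 ⊢
            nlinarith
        exact h5 _ _ hP (ht a) j
      · intro J hJ K hK h
        have hJ' : a ∉ J := fun h => ha ((Finset.mem_powersetCard.1 hJ).1 h)
        have hK' : a ∉ K := fun h => ha ((Finset.mem_powersetCard.1 hK).1 h)
        rw [← Finset.erase_insert hJ', ← Finset.erase_insert hK', h]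
      · rw [Finset.disjoint_left]
        intro J hJ hJ'
        obtain ⟨K, _, rfl⟩ := Finset.mem_image.1 hJ'
        exact ha ((Finset.mem_powersetCard.1 hJ).1 (Finset.mem_insert_self a K))

lemma add_one_pow_le_four_pow_mul_factorial (j : ℕ) :
    ((j : ℝ) + 1) ^ j ≤ 4 ^ j * j.factorial := by
  induction j with
  | zero => simp
  | succ j ih =>
    have h1 : ((j : ℝ) + 1 + 1) ^ (j + 1) ≤ 4 * ((j : ℝ) + 1) ^ (j + 1) := by
      have h2 : (1 + 1 / ((j : ℝ) + 1)) ^ (j + 1) ≤ 4 := by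
        calc (1 + 1 / ((j : ℝ) + 1)) ^ (j + 1)
            ≤ (Real.exp (1 / ((j : ℝ) + 1))) ^ (j + 1) := by
              gcongr
              linarith [Real.add_one_le_exp (1 / ((j : ℝ) + 1))]
          _ = Real.exp 1 := by
              rw [← Real.exp_nat_mul]
              congr 1
              push_cast
              field_simp
          _ ≤ 4 := by linarith [Real.exp_one_lt_d9]
      have h3 : (j : ℝ) + 1 + 1 = (1 + 1 / ((j : ℝ) + 1)) * (j + 1) := by
        field_simp
      rw [h3, mul_pow]
      gcongr
    push_cast
    refine h1.trans ?_
    rw [Nat.factorial_succ, pow_succ, pow_succ]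
    push_cast
    nlinarith [(by positivity : (0 : ℝ) ≤ (j : ℝ) + 1)]

/-- Grouping by cardinality `j`, the factor `(j + 1) ^ j ≤ 4 ^ j * j!` is absorbed by the `j!` in
the bound for elementary symmetric sums. What is left is a geometric series of ratio `4 * ∑ t k`
without its constant term. -/
lemma sum_nonempty_prod_mul_pow_le {α : Type*} [Fintype α] [DecidableEq α] (t : α → ℝ)
    (ht : ∀ k, 0 ≤ t k) (hT : 4 * ∑ k, t k < 1) :
    ∑ J : Finset α with J.Nonempty, (∏ k ∈ J, t k) * ((J.card : ℝ) + 1) ^ J.card ≤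
      4 * (∑ k, t k) / (1 - 4 * ∑ k, t k) := by
  set T := ∑ k, t k with hTd
  have hT0 : 0 ≤ T := Finset.sum_nonneg fun k _ => ht k
  have h1 : ∀ j : ℕ, ∑ J ∈ (Finset.univ : Finset α).powersetCard j,
      (∏ k ∈ J, t k) * ((J.card : ℝ) + 1) ^ J.card ≤ (4 * T) ^ j := by
    intro j
    have : ∀ J ∈ (Finset.univ : Finset α).powersetCard j,
        (∏ k ∈ J, t k) * ((J.card : ℝ) + 1) ^ J.card ≤ (∏ k ∈ J, t k) * (4 ^ j * j.factorial) := by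
      intro J hJ
      rw [(Finset.mem_powersetCard.1 hJ).2]
      exact mul_le_mul_of_nonneg_left (add_one_pow_le_four_pow_mul_factorial j)
        (Finset.prod_nonneg fun k _ => ht k)
    refine (Finset.sum_le_sum this).trans ?_
    rw [← Finset.sum_mul, mul_pow]
    have := Finset.factorial_mul_sum_powersetCard_prod_le t ht Finset.univ j
    nlinarith [(by positivity : (0 : ℝ) < 4 ^ j)]
  have h2 : ∑ J : Finset α with J.Nonempty, (∏ k ∈ J, t k) * ((J.card : ℝ) + 1) ^ J.card =
      (∑ J : Finset α, (∏ k ∈ J, t k) * ((J.card : ℝ) + 1) ^ J.card) - 1 := by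
    rw [← Finset.sum_filter_add_sum_filter_not Finset.univ (fun J : Finset α => J.Nonempty)]
    simp [Finset.filter_eq']
  have h3 : ∑ J : Finset α, (∏ k ∈ J, t k) * ((J.card : ℝ) + 1) ^ J.card ≤ (1 - 4 * T)⁻¹ := by
    rw [← Finset.powerset_univ, Finset.sum_powerset]
    refine (Finset.sum_le_sum fun j _ => h1 j).trans ?_
    rw [← tsum_geometric_of_lt_one (by positivity) hT]
    exact (summable_geometric_of_lt_one (by positivity) hT).sum_le_tsum _
      (fun j _ => by positivity)
  rw [h2]
  have h4 : 0 < 1 - 4 * T := by linarith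
  rw [le_div_iff₀ h4]
  have := mul_le_mul_of_nonneg_right h3 h4.le
  rw [inv_mul_cancel₀ h4.ne'] at this
  linarith

/-- The matrix whose `j`-th row is that of the identity if `ψ j = none`, and the `i`-th row of `X`
if `ψ j = some i`. -/
def optionRow {n : Type*} [DecidableEq n] (X : Matrix n n ℂ) (ψ : n → Option n) : Matrix n n ℂ :=
  Matrix.of fun j k => (ψ j).elim ((1 : Matrix n n ℂ) j k) fun i => X i k

/-- The terms are the squared coefficients of `det ((D + G) X) - 1`. They are grouped by the set `J`
of rows where the Gaussian part is chosen, and each group is bounded through Hadamard with weights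
adapted to `J`. -/
lemma sum_option_norm_det_sub_sq_le {n : Type*} [Fintype n] [DecidableEq n] (X : Matrix n n ℂ)
    (t : n → ℝ) (ht0 : ∀ k, 0 < t k) (ht : ∀ k, ∑ i, ‖X i k‖ ^ 2 ≤ t k)
    (hT : 4 * ∑ k, t k < 1) :
    ∑ ψ : n → Option n, ‖(optionRow X ψ).det -
      if ψ = (fun _ => none) then 1 else 0‖ ^ 2 ≤ 4 * (∑ k, t k) / (1 - 4 * ∑ k, t k) := by
  set T := ∑ k, t k with hTd
  -- With these weights each column in `J` has total mass at most `1`, and all columns with weight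
  -- `T⁻¹` together at most `1`; this is the source of `J.card + 1`.
  set q : Finset n → n → ℝ := fun J k => if k ∈ J then (t k)⁻¹ else T⁻¹ with hq
  have hTpos : ∀ k : n, 0 < T := fun k =>
    (ht0 k).trans_le (Finset.single_le_sum (fun k _ => (ht0 k).le) (Finset.mem_univ k))
  have hqpos : ∀ J k, 0 < q J k := by
    intro J k
    simp only [hq]
    split_ifs
    · exact inv_pos.2 (ht0 k)
    · exact inv_pos.2 (hTpos k)
  -- The product of `u J j (ψ j)` over `j` vanishes unless `J` is exactly the set where `ψ j ≠
  -- none`. The constraint thus becomes a product over rows, and the sum over `ψ` factorises.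
  set u : Finset n → n → Option n → ℝ := fun J j o =>
    o.elim (if j ∈ J then 0 else 1) fun i => if j ∈ J then ∑ k, q J k * ‖X i k‖ ^ 2 else 0 with hu
  have hu0 : ∀ J j o, 0 ≤ u J j o := by
    intro J j o
    have : ∀ i, 0 ≤ ∑ k, q J k * ‖X i k‖ ^ 2 := fun i =>
      Finset.sum_nonneg fun k _ => mul_nonneg (hqpos J k).le (by positivity)
    cases o <;> simp only [hu, Option.elim] <;> split_ifs <;> simp [this]
  have hpt : ∀ ψ : n → Option n, ‖(optionRow X ψ).det -
      if ψ = (fun _ => none) then 1 else 0‖ ^ 2 ≤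
      ∑ J : Finset n with J.Nonempty, (∏ k ∈ J, t k) * ∏ j, u J j (ψ j) := by
    intro ψ
    have hnn : ∀ J : Finset n, 0 ≤ (∏ k ∈ J, t k) * ∏ j, u J j (ψ j) := fun J =>
      mul_nonneg (Finset.prod_nonneg fun k _ => (ht0 k).le) (Finset.prod_nonneg fun j _ => hu0 J j _)
    by_cases hψ : ψ = fun _ => none
    · rw [if_pos hψ, hψ]
      have : (optionRow X fun _ => none).det = 1 := Matrix.det_one
      rw [this]
      simp only [sub_self, norm_zero, ne_eq, OfNat.ofNat_ne_zero, not_false_eq_true, zero_pow]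
      exact Finset.sum_nonneg fun J _ => by
        simpa [hψ] using hnn J
    · rw [if_neg hψ, sub_zero]
      set J : Finset n := Finset.univ.filter fun j => ψ j ≠ none with hJ
      have hJne : J.Nonempty := by
        by_contra h
        rw [Finset.not_nonempty_iff_eq_empty] at h
        refine hψ (funext fun j => ?_)
        by_contra hj
        have : j ∈ J := by simp [hJ, hj]
        simp [h] at this
      refine le_trans ?_ (Finset.single_le_sum (fun J _ => hnn J)
        (Finset.mem_filter.2 ⟨Finset.mem_univ J, hJne⟩))
      refine (Matrix.norm_det_sq_le_of_row_eq_one _ J ?_ (q J) (hqpos J)).trans (le_of_eq ?_)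
      · intro j hj
        have : ψ j = none := by simpa [hJ] using hj
        ext k
        simp [optionRow, this]
      · congr 1
        · refine Finset.prod_congr rfl fun k hk => ?_
          simp [hq, hk]
        · rw [← Finset.prod_compl_mul_prod J]
          rw [Finset.prod_eq_one (s := Jᶜ), one_mul]
          · refine Finset.prod_congr rfl fun j hj => ?_
            obtain ⟨i, hi⟩ := Option.ne_none_iff_exists'.1 (Finset.mem_filter.1 hj).2
            simp [hu, hi, hj, optionRow]
          · intro j hj
            have hj' : j ∉ J := by simpa using hj
            have : ψ j = none := by simpa [hJ] using hj'
            simp [hu, this, hj']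
  refine (Finset.sum_le_sum fun ψ _ => hpt ψ).trans ?_
  rw [Finset.sum_comm]
  refine le_trans (Finset.sum_le_sum fun J _ => ?_)
    (sum_nonempty_prod_mul_pow_le t (fun k => (ht0 k).le) hT)
  rw [← Finset.mul_sum]
  refine mul_le_mul_of_nonneg_left ?_ (Finset.prod_nonneg fun k _ => (ht0 k).le)
  have hprod : ∑ ψ : n → Option n, ∏ j, u J j (ψ j) = ∏ j, ∑ o, u J j o := by
    rw [Finset.prod_univ_sum, Fintype.piFinset_univ]
  have hS : ∑ i, ∑ k, q J k * ‖X i k‖ ^ 2 ≤ (J.card : ℝ) + 1 := by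
    rw [Finset.sum_comm]
    have h1 : ∀ k, ∑ i, q J k * ‖X i k‖ ^ 2 ≤ (if k ∈ J then 1 else 0) + T⁻¹ * t k := by
      intro k
      rw [← Finset.mul_sum]
      refine (mul_le_mul_of_nonneg_left (ht k) (hqpos J k).le).trans ?_
      simp only [hq]
      split_ifs
      · rw [inv_mul_cancel₀ (ht0 k).ne']
        linarith [mul_nonneg (inv_nonneg.2 (hTpos k).le) (ht0 k).le]
      · simp
    refine (Finset.sum_le_sum fun k _ => h1 k).trans ?_
    rw [Finset.sum_add_distrib, ← Finset.mul_sum, ← hTd]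
    have : T⁻¹ * T ≤ 1 := inv_mul_le_one
    simpa using this
  rw [hprod, ← Finset.prod_compl_mul_prod J]
  have h1 : ∏ j ∈ Jᶜ, ∑ o, u J j o = 1 := by
    refine Finset.prod_eq_one fun j hj => ?_
    have hj' : j ∉ J := by simpa using hj
    simp [Fintype.sum_option, hu, hj']
  rw [h1, one_mul, ← Finset.prod_const]
  refine Finset.prod_le_prod (fun j _ => Finset.sum_nonneg fun o _ => hu0 J j o) fun j hj => ?_
  simpa [Fintype.sum_option, hu, hj] using hS

/-- The determinant of `(D + G) X`, for `X = D⁻¹` with small Frobenius norm and a real Gaussian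
matrix `G`, is close to `1`. -/
lemma lintegral_enorm_det_mul_sub_one_sq_le {m : ℕ} (D X : Matrix (Fin m) (Fin m) ℂ)
    (hDX : D * X = 1) (hT : 4 * ∑ k, ∑ i, ‖X i k‖ ^ 2 < 1) :
    ∫⁻ g, ‖(Matrix.of (realShift D g) * X).det - 1‖ₑ ^ 2
        ∂(Measure.pi fun _ : Fin m => stdGaussianPi (Fin m)) ≤
      ENNReal.ofReal (4 * (∑ k, ∑ i, ‖X i k‖ ^ 2) / (1 - 4 * ∑ k, ∑ i, ‖X i k‖ ^ 2)) := by
  -- Right multiplication by `X` sends row `j` of `D` to the unit row `e_j`, and `e_i` to the `i`-th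
  -- row of `X`; these are the two cases of `optionRow`.
  set f : MultilinearMap ℂ (fun _ : Fin m => Fin m → ℂ) ℂ :=
    (Matrix.detRowAlternating (R := ℂ) (n := Fin m)).toMultilinearMap.compLinearMap
      fun _ => X.vecMulLinear with hf
  have hfv : ∀ v, f v = (Matrix.of v * X).det := fun v => rfl
  have h1 := lintegral_multilinear_sq_le m f D 1
  simp_rw [hfv] at h1
  refine h1.trans ?_
  have hpos : ∀ k, 0 < ∑ i, ‖X i k‖ ^ 2 := by
    intro k
    refine lt_of_le_of_ne (Finset.sum_nonneg fun i _ => by positivity) fun h => ?_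
    have h2 : ∀ i, X i k = 0 := fun i => by
      have := (Finset.sum_eq_zero_iff_of_nonneg (fun j _ => by positivity)).1 h.symm i
        (Finset.mem_univ i)
      simpa using this
    have h3 := congrFun (congrFun hDX k) k
    simp [Matrix.mul_apply, h2] at h3
  have h2 := sum_option_norm_det_sub_sq_le X _ hpos (fun k => le_rfl) hT
  refine le_trans (le_of_eq ?_) (ENNReal.ofReal_le_ofReal h2)
  rw [ENNReal.ofReal_sum_of_nonneg (fun ψ _ => by positivity)]
  refine Finset.sum_congr rfl fun ψ _ => ?_
  rw [ENNReal.ofReal_pow (norm_nonneg _), ofReal_norm]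
  congr 4
  ext j k
  cases hj : ψ j with
  | none =>
    simp only [optionRow, Matrix.of_apply, hj, Option.elim_none]
    rw [← hDX, Matrix.mul_apply, Matrix.mul_apply]
    simp [hj]
  | some i =>
    simp [optionRow, Matrix.mul_apply, hj, Pi.single_apply]

/-! ### Small ball estimate for a determinant with a well-conditioned minor. -/

lemma measurePreserving_comp_inl (m s : ℕ) :
    MeasurePreserving (fun (h : Fin m → (Fin m ⊕ Fin s) → ℝ) j k => h j (Sum.inl k))
      (Measure.pi fun _ => stdGaussianPi (Fin m ⊕ Fin s))
      (Measure.pi fun _ => stdGaussianPi (Fin m)) := by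
  refine measurePreserving_pi (f := fun (_ : Fin m) (x : (Fin m ⊕ Fin s) → ℝ) k => x (Sum.inl k))
    _ _ fun _ => ?_
  exact measurePreserving_fst.comp
    (measurePreserving_sumPiEquivProdPi (fun _ : Fin m ⊕ Fin s => gaussianReal 0 1))

/-- The determinant as a multilinear function of the last `s` rows. -/
noncomputable def detLastRows {m s : ℕ} (u : Fin m → (Fin m ⊕ Fin s) → ℂ) :
    MultilinearMap ℂ (fun _ : Fin s => (Fin m ⊕ Fin s) → ℂ) ℂ :=
  (Matrix.detRowAlternating (R := ℂ) (n := Fin m ⊕ Fin s)).toMultilinearMap.currySum u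

lemma detLastRows_apply {m s : ℕ} (u : Fin m → (Fin m ⊕ Fin s) → ℂ)
    (v : Fin s → (Fin m ⊕ Fin s) → ℂ) :
    detLastRows u v = (Matrix.of (Sum.elim u v)).det := rfl

/-- Among all `φ`, only the `s!` bijections onto the last `s` columns are kept. Each gives a block
triangular matrix whose lower right block is a permutation matrix. -/
lemma sum_detLastRows_single_ge {m s : ℕ} (u : Fin m → (Fin m ⊕ Fin s) → ℂ) :
    (s.factorial : ℝ≥0∞) * ‖(Matrix.of fun j k => u j (Sum.inl k)).det‖ₑ ^ 2 ≤
      ∑ φ : Fin s → Fin m ⊕ Fin s, ‖detLastRows u (fun j => Pi.single (φ j) 1)‖ₑ ^ 2 := by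
  have hdet : ∀ π : Equiv.Perm (Fin s),
      ‖detLastRows u (fun j => Pi.single (Sum.inr (π j)) 1)‖ₑ =
        ‖(Matrix.of fun j k => u j (Sum.inl k)).det‖ₑ := by
    intro π
    have h1 : Matrix.of (Sum.elim u fun j => Pi.single (Sum.inr (π j)) (1 : ℂ)) =
        Matrix.fromBlocks (Matrix.of fun j k => u j (Sum.inl k))
          (Matrix.of fun j k => u j (Sum.inr k)) 0 (π.permMatrix ℂ) := by
      ext i j
      rcases i with i | i <;> rcases j with j | j <;>
        simp [Matrix.fromBlocks, Pi.single_apply, Equiv.Perm.permMatrix]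
    rw [detLastRows_apply, h1, Matrix.det_fromBlocks_zero₂₁, Matrix.det_permutation, enorm_mul]
    rcases Int.units_eq_one_or (Equiv.Perm.sign π) with h | h <;> simp [h]
  have hinj : Function.Injective fun (π : Equiv.Perm (Fin s)) (j : Fin s) =>
      (Sum.inr (π j) : Fin m ⊕ Fin s) := by
    intro π π' h
    ext j
    have := congrFun h j
    simpa using congrArg Fin.val (Sum.inr_injective this)
  calc (s.factorial : ℝ≥0∞) * ‖(Matrix.of fun j k => u j (Sum.inl k)).det‖ₑ ^ 2
      = ∑ π : Equiv.Perm (Fin s),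
          ‖detLastRows u (fun j => Pi.single (Sum.inr (π j)) 1)‖ₑ ^ 2 := by
        simp [hdet, Fintype.card_perm]
    _ = ∑ φ ∈ Finset.univ.map ⟨_, hinj⟩, ‖detLastRows u (fun j => Pi.single (φ j) 1)‖ₑ ^ 2 := by
        rw [Finset.sum_map]
        rfl
    _ ≤ _ := Finset.sum_le_sum_of_subset (Finset.subset_univ _)

/-- Small ball estimate for the determinant given its first `m` rows. -/
lemma measure_detLastRows_le {m s : ℕ} (u : Fin m → (Fin m ⊕ Fin s) → ℂ)
    (b : Fin s → (Fin m ⊕ Fin s) → ℂ) {c θ : ℝ} (hc : 0 < c) (hθ : 0 < θ)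
    (hu : c ≤ ‖(Matrix.of fun j k => u j (Sum.inl k)).det‖) :
    (Measure.pi fun _ : Fin s => stdGaussianPi (Fin m ⊕ Fin s))
        {g | ‖detLastRows u (realShift b g)‖ ≤ c * √s.factorial * θ} ≤
      6 ^ s * ENNReal.ofReal (√θ) := by
  set μ := Measure.pi fun _ : Fin s => stdGaussianPi (Fin m ⊕ Fin s)
  have hmom := lintegral_multilinear_rpow_le (ι := Fin m ⊕ Fin s) s Unit
    (fun _ => detLastRows u) b
  simp only [Finset.univ_unique, Finset.sum_singleton] at hmom
  have hmeas : Measurable fun g : Fin s → (Fin m ⊕ Fin s) → ℝ =>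
      (‖detLastRows u (realShift b g)‖ₑ ^ 2) ^ (-(1 / 4) : ℝ) :=
    ((measurable_multilinear_realShift _ _).enorm.pow_const 2).pow_const _
  have hs : (0 : ℝ) < s.factorial := by exact_mod_cast s.factorial_pos
  set a : ℝ := s.factorial * c ^ 2 with ha
  have ha0 : 0 < a := by positivity
  have h1 : (∑ φ : Fin s → Fin m ⊕ Fin s,
      ‖detLastRows u (fun j => Pi.single (φ j) 1)‖ₑ ^ 2) ^ (-(1 / 4) : ℝ) ≤
      ENNReal.ofReal a ^ (-(1 / 4) : ℝ) := by
    refine ENNReal.rpow_le_rpow_neg (by norm_num) (le_trans ?_ (sum_detLastRows_single_ge u))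
    rw [ha, ENNReal.ofReal_mul hs.le, ENNReal.ofReal_natCast, ENNReal.ofReal_pow hc.le]
    gcongr
    rw [← ofReal_norm]
    exact ENNReal.ofReal_le_ofReal hu
  set e : ℝ≥0∞ := ENNReal.ofReal (a * θ ^ 2) ^ (-(1 / 4) : ℝ) with he
  have hsub : {g | ‖detLastRows u (realShift b g)‖ ≤ c * √s.factorial * θ} ⊆
      {g | e ≤ (‖detLastRows u (realShift b g)‖ₑ ^ 2) ^ (-(1 / 4) : ℝ)} := by
    intro g hg
    refine ENNReal.rpow_le_rpow_neg (by norm_num) ?_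
    rw [← ofReal_norm, ← ENNReal.ofReal_pow (norm_nonneg _)]
    refine ENNReal.ofReal_le_ofReal ?_
    calc ‖detLastRows u (realShift b g)‖ ^ 2 ≤ (c * √s.factorial * θ) ^ 2 := by
          gcongr; exact hg
      _ = a * θ ^ 2 := by
          rw [mul_pow, mul_pow, Real.sq_sqrt hs.le, ha]; ring
  -- Markov's inequality at level `(a θ²) ^ (-1/4) = a ^ (-1/4) / √θ`; the factor `a ^ (-1/4)`
  -- cancels against the moment bound.
  have hmk := (mul_meas_ge_le_lintegral₀ (μ := μ) hmeas.aemeasurable e).trans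
    (hmom.trans (mul_le_mul_right h1 _))
  have haa : ENNReal.ofReal (a * θ ^ 2) = ENNReal.ofReal a * ENNReal.ofReal θ ^ 2 := by
    rw [ENNReal.ofReal_mul ha0.le, ENNReal.ofReal_pow hθ.le]
  have hane : ENNReal.ofReal a ≠ 0 := by simpa using ha0
  have hθne : ENNReal.ofReal θ ≠ 0 := by simpa using hθ
  have he2 : e = ENNReal.ofReal a ^ (-(1 / 4) : ℝ) * (ENNReal.ofReal (√θ))⁻¹ := by
    rw [he, haa, ENNReal.mul_rpow_of_ne_top (by simp) (by simp), ← ENNReal.rpow_natCast,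
      ← ENNReal.rpow_mul, Real.sqrt_eq_rpow, ← ENNReal.ofReal_rpow_of_pos hθ, ← ENNReal.rpow_neg]
    norm_num
  have hA0 : ENNReal.ofReal a ^ (-(1 / 4) : ℝ) ≠ 0 := by simp
  have hAt : ENNReal.ofReal a ^ (-(1 / 4) : ℝ) ≠ ⊤ := by simp [ha0]
  refine (measure_mono hsub).trans ?_
  rw [he2, mul_assoc, mul_comm (6 ^ s : ℝ≥0∞), ENNReal.mul_le_mul_iff_right hA0 hAt,
    mul_comm, ← div_eq_mul_inv] at hmk
  rw [he2]
  exact (ENNReal.div_le_iff (by simpa using hθ) (by simp)).1 hmk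

/-- Small ball estimate for the determinant of `A + G`, for a real Gaussian matrix `G` and a matrix
`A` with a well-conditioned `m × m` block. -/
lemma measure_prod_norm_det_le {m s : ℕ} (u : Fin m → (Fin m ⊕ Fin s) → ℂ)
    (b : Fin s → (Fin m ⊕ Fin s) → ℂ) (D X : Matrix (Fin m) (Fin m) ℂ)
    (hD : ∀ j k, u j (Sum.inl k) = D j k) (hDX : D * X = 1) {t θ : ℝ}
    (ht : ∑ k, ∑ i, ‖X i k‖ ^ 2 = t) (hT : 4 * t < 1) (hθ : 0 < θ) :
    ((Measure.pi fun _ : Fin m => stdGaussianPi (Fin m ⊕ Fin s)).prod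
      (Measure.pi fun _ : Fin s => stdGaussianPi (Fin m ⊕ Fin s)))
        {p | ‖(Matrix.of (Sum.elim (realShift u p.1) (realShift b p.2))).det‖ ≤
          2⁻¹ * ‖D.det‖ * √s.factorial * θ} ≤
      4 * ENNReal.ofReal (4 * t / (1 - 4 * t)) + 6 ^ s * ENNReal.ofReal (√θ) := by
  set μ₂ := Measure.pi fun _ : Fin m => stdGaussianPi (Fin m ⊕ Fin s)
  set μ₁ := Measure.pi fun _ : Fin s => stdGaussianPi (Fin m ⊕ Fin s)
  have hdet : D.det * X.det = 1 := by rw [← Matrix.det_mul, hDX, Matrix.det_one]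
  have hD0 : 0 < ‖D.det‖ := norm_pos_iff.2 (left_ne_zero_of_mul_eq_one hdet)
  set E : Set ((Fin m → (Fin m ⊕ Fin s) → ℝ) × (Fin s → (Fin m ⊕ Fin s) → ℝ)) :=
    {p | ‖(Matrix.of (Sum.elim (realShift u p.1) (realShift b p.2))).det‖ ≤
          2⁻¹ * ‖D.det‖ * √s.factorial * θ} with hE
  have hcont : Continuous fun p : (Fin m → (Fin m ⊕ Fin s) → ℝ) × (Fin s → (Fin m ⊕ Fin s) → ℝ) =>
      (Matrix.of (Sum.elim (realShift u p.1) (realShift b p.2))).det := by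
    refine Continuous.matrix_det ?_
    refine continuous_matrix fun i j => ?_
    rcases i with i | i <;> simp only [Matrix.of_apply, Sum.elim_inl, Sum.elim_inr, realShift] <;>
      fun_prop
  have hEm : MeasurableSet E := measurableSet_le hcont.norm.measurable measurable_const
  set Z : (Fin m → (Fin m ⊕ Fin s) → ℝ) → ℝ≥0∞ := fun h =>
    ‖(Matrix.of (realShift D fun j k => h j (Sum.inl k)) * X).det - 1‖ₑ ^ 2 with hZ
  have hZm : Measurable fun g : Fin m → Fin m → ℝ =>
      ‖(Matrix.of (realShift D g) * X).det - 1‖ₑ ^ 2 := by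
    have : Continuous fun g : Fin m → Fin m → ℝ => (Matrix.of (realShift D g) * X).det := by
      refine Continuous.matrix_det (Continuous.matrix_mul ?_ continuous_const)
      refine continuous_matrix fun i j => ?_
      simp only [Matrix.of_apply, realShift]
      fun_prop
    exact (this.measurable.sub_const 1).enorm.pow_const 2
  have hZint : ∫⁻ h, Z h ∂μ₂ ≤ ENNReal.ofReal (4 * t / (1 - 4 * t)) := by
    have h1 := (measurePreserving_comp_inl m s).lintegral_comp hZm
    have h2 := lintegral_enorm_det_mul_sub_one_sq_le D X hDX (by rwa [ht])
    rw [ht] at h2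
    exact h1.le.trans h2
  -- The first `m` rows are fixed. Either the minor is at least `|det D| / 2` and the conditional
  -- small ball bound applies, or `|w| ≤ 1/2`, so that `|w - 1| ≥ 1/2` and `4 * Z h ≥ 1` bounds the
  -- probability trivially.
  have hpt : ∀ h, μ₁ (Prod.mk h ⁻¹' E) ≤ 4 * Z h + 6 ^ s * ENNReal.ofReal (√θ) := by
    intro h
    by_cases hb : 2⁻¹ * ‖D.det‖ ≤
        ‖(Matrix.of fun j k => realShift u h j (Sum.inl k)).det‖
    · exact (measure_detLastRows_le (realShift u h) b (by positivity) hθ hb).trans le_add_self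
    · refine le_trans ?_ le_self_add
      refine (prob_le_one (μ := μ₁)).trans ?_
      have h1 : (Matrix.of fun j k => realShift u h j (Sum.inl k)) =
          Matrix.of (realShift D fun j k => h j (Sum.inl k)) := by
        ext j k
        simp [realShift, hD]
      rw [h1] at hb
      set w := (Matrix.of (realShift D fun j k => h j (Sum.inl k)) * X).det with hw
      have h2 : ‖w‖ ≤ 2⁻¹ := by
        rw [hw, Matrix.det_mul, norm_mul]
        have hX : ‖D.det‖ * ‖X.det‖ = 1 := by rw [← norm_mul, hdet, norm_one]
        have := mul_le_mul_of_nonneg_right (not_le.1 hb).le (norm_nonneg X.det)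
        rwa [mul_assoc, hX, mul_one] at this
      have h3 : 2⁻¹ ≤ ‖w - 1‖ := by
        have := norm_sub_norm_le 1 w
        rw [norm_one, norm_sub_rev] at this
        linarith
      have h4 : (2⁻¹ : ℝ≥0∞) ≤ ‖w - 1‖ₑ := by
        rw [← ofReal_norm]
        calc (2⁻¹ : ℝ≥0∞) = ENNReal.ofReal 2⁻¹ := by
              rw [ENNReal.ofReal_inv_of_pos (by norm_num)]; simp
          _ ≤ _ := ENNReal.ofReal_le_ofReal h3
      calc (1 : ℝ≥0∞) = 4 * (2⁻¹) ^ 2 := by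
            rw [← ENNReal.inv_pow]
            norm_num
            rw [ENNReal.mul_inv_cancel (by norm_num) (by norm_num)]
        _ ≤ 4 * Z h := by
            simp only [hZ, ← hw]
            gcongr
  rw [Measure.prod_apply hEm]
  refine (lintegral_mono hpt).trans ?_
  have hZm' : Measurable Z := hZm.comp (measurePreserving_comp_inl m s).measurable
  rw [lintegral_add_right _ measurable_const, lintegral_const_mul _ hZm']
  simp only [lintegral_const, measure_univ, mul_one]
  gcongr

lemma map_curry_pi {α β : Type*} [Fintype α] [Fintype β] (μ : Measure ℝ) [SigmaFinite μ] :
    (Measure.pi fun _ : α × β => μ).map (fun f a b => f (a, b)) =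
      Measure.pi fun _ : α => Measure.pi fun _ : β => μ := by
  have h1 : Measure.pi (fun _ : α × β => μ) =
      (Measure.pi fun _ : α => Measure.pi fun _ : β => μ).map (fun f (p : α × β) => f p.1 p.2) := by
    refine Measure.pi_eq fun s hs => ?_
    rw [Measure.map_apply (by fun_prop) (MeasurableSet.univ_pi hs)]
    have : (fun f (p : α × β) => f p.1 p.2) ⁻¹' (Set.univ.pi s) =
        Set.univ.pi fun a => Set.univ.pi fun b => s (a, b) := by
      ext f
      simp [Set.mem_pi]
    rw [this, Measure.pi_pi]
    simp_rw [Measure.pi_pi]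
    rw [Fintype.prod_prod_type]
  rw [h1, Measure.map_map (by fun_prop) (by fun_prop)]
  exact Measure.map_id

/-- The rows of a standard Gaussian matrix, arranged by two enumerations of its rows and columns. -/
lemma IsStandardGaussianMatrix.hasLaw_rows {Ω : Type*} [MeasurableSpace Ω] {P : Measure Ω}
    [IsProbabilityMeasure P] {N m s : ℕ} {G : Ω → Matrix (Fin N) (Fin N) ℝ}
    (hG : IsStandardGaussianMatrix P G) (e₁ e₂ : Fin m ⊕ Fin s ≃ Fin N) :
    HasLaw (fun ω => ((fun j k => G ω (e₁ (Sum.inl j)) (e₂ k)),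
        (fun j k => G ω (e₁ (Sum.inr j)) (e₂ k))))
      ((Measure.pi fun _ : Fin m => stdGaussianPi (Fin m ⊕ Fin s)).prod
        (Measure.pi fun _ : Fin s => stdGaussianPi (Fin m ⊕ Fin s))) P := by
  have hinj : Function.Injective fun p : (Fin m ⊕ Fin s) × (Fin m ⊕ Fin s) => (e₁ p.1, e₂ p.2) := by
    rintro ⟨a, b⟩ ⟨c, d⟩ h
    simpa using h
  have hind := hG.1.precomp hinj
  have hae : ∀ p : (Fin m ⊕ Fin s) × (Fin m ⊕ Fin s),
      AEMeasurable (fun ω => G ω (e₁ p.1) (e₂ p.2)) P := fun p => (hG.2 _ _).aemeasurable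
  have h1 := (iIndepFun_iff_map_fun_eq_pi_map hae).1 hind
  simp only [fun p : (Fin m ⊕ Fin s) × (Fin m ⊕ Fin s) => (hG.2 (e₁ p.1) (e₂ p.2)).map_eq] at h1
  have hL1 : HasLaw (fun ω (p : (Fin m ⊕ Fin s) × (Fin m ⊕ Fin s)) => G ω (e₁ p.1) (e₂ p.2))
      (Measure.pi fun _ => gaussianReal 0 1) P := ⟨aemeasurable_pi_lambda _ hae, h1⟩
  have hL2 : HasLaw (fun (f : (Fin m ⊕ Fin s) × (Fin m ⊕ Fin s) → ℝ) a b => f (a, b))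
      (Measure.pi fun _ : Fin m ⊕ Fin s => stdGaussianPi (Fin m ⊕ Fin s))
      (Measure.pi fun _ => gaussianReal 0 1) :=
    ⟨(by fun_prop : Measurable _).aemeasurable, map_curry_pi _⟩
  have hL3 := (measurePreserving_sumPiEquivProdPi
    (fun _ : Fin m ⊕ Fin s => stdGaussianPi (Fin m ⊕ Fin s))).hasLaw
  exact hL3.comp (hL2.comp hL1)

lemma exists_equiv_extending {κ : Type*} [Fintype κ] {N m s : ℕ} (hN : m + s = N)
    (e : Fin m ≃ κ) (f : κ → Fin N) (hf : Function.Injective f) :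
    ∃ e' : Fin m ⊕ Fin s ≃ Fin N, ∀ j, e' (Sum.inl j) = f (e j) := by
  classical
  have hm : Fintype.card κ = m := by rw [← Fintype.card_congr e, Fintype.card_fin]
  have hcard : Fintype.card (((Set.range f)ᶜ : Set (Fin N)) : Type) = s := by
    rw [Fintype.card_compl_set, Fintype.card_fin, Set.card_range_of_injective hf, hm]
    omega
  let e2 : Fin s ≃ ((Set.range f)ᶜ : Set (Fin N)) := (Fintype.equivFinOfCardEq hcard).symm
  refine ⟨((e.trans (Equiv.ofInjective f hf)).sumCongr e2).trans (Equiv.Set.sumCompl _), ?_⟩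
  intro j
  simp

lemma Matrix.norm_det_submatrix_equiv {m n : Type*} [Fintype m] [DecidableEq m] [Fintype n]
    [DecidableEq n] (A : Matrix n n ℂ) (e₁ e₂ : m ≃ n) :
    ‖(A.submatrix e₁ e₂).det‖ = ‖A.det‖ := by
  have h1 : A.submatrix e₁ e₂ = (A.submatrix (e₂.symm.trans e₁) id).submatrix e₂ e₂ := by
    ext i j
    simp
  rw [h1, Matrix.det_submatrix_equiv_self]
  have h2 := Matrix.det_permute (e₂.symm.trans e₁ : Equiv.Perm n) A
  rw [h2, norm_mul]
  rcases Int.units_eq_one_or (Equiv.Perm.sign (e₂.symm.trans e₁ : Equiv.Perm n)) with h | h <;>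
    simp [h]

/-- Small ball estimate for the determinant of `B + G`, where `G` is a real standard Gaussian matrix
and `B` has a submatrix `D`, with `s` rows and columns deleted, whose inverse `X` has a small
Frobenius norm. -/
lemma IsStandardGaussianMatrix.measure_norm_det_le {Ω : Type*} [MeasurableSpace Ω] {P : Measure Ω}
    [IsProbabilityMeasure P] {N s : ℕ} {G : Ω → Matrix (Fin N) (Fin N) ℝ}
    (hG : IsStandardGaussianMatrix P G) (B : Matrix (Fin N) (Fin N) ℂ)
    {κ : Type*} [Fintype κ] [DecidableEq κ] (hs : Fintype.card κ + s = N) (ρ χ : κ → Fin N)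
    (hρ : Function.Injective ρ) (hχ : Function.Injective χ) (X : Matrix κ κ ℂ)
    (hX : B.submatrix ρ χ * X = 1) {t θ : ℝ} (ht : ∑ k, ∑ i, ‖X i k‖ ^ 2 = t) (hT : 4 * t < 1)
    (hθ : 0 < θ) :
    P {ω | ‖(B + (G ω).map Complex.ofReal).det‖ ≤
        2⁻¹ * ‖(B.submatrix ρ χ).det‖ * √s.factorial * θ} ≤
      4 * ENNReal.ofReal (4 * t / (1 - 4 * t)) + 6 ^ s * ENNReal.ofReal (√θ) := by
  let e : Fin (Fintype.card κ) ≃ κ := (Fintype.equivFin κ).symm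
  obtain ⟨e₁, he₁⟩ := exists_equiv_extending hs e ρ hρ
  obtain ⟨e₂, he₂⟩ := exists_equiv_extending hs e χ hχ
  set D : Matrix (Fin (Fintype.card κ)) (Fin (Fintype.card κ)) ℂ :=
    (B.submatrix ρ χ).submatrix e e with hD
  have hDdet : D.det = (B.submatrix ρ χ).det := Matrix.det_submatrix_equiv_self e _
  have hDX : D * X.submatrix e e = 1 := by
    rw [hD, Matrix.submatrix_mul_equiv, hX, Matrix.submatrix_one_equiv]
  have hsum : ∑ k, ∑ i, ‖X.submatrix e e i k‖ ^ 2 = t := by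
    rw [← ht, ← e.sum_comp]
    refine Finset.sum_congr rfl fun k _ => ?_
    rw [← e.sum_comp]
    rfl
  have hmain := measure_prod_norm_det_le (fun j k => B (e₁ (Sum.inl j)) (e₂ k))
    (fun j k => B (e₁ (Sum.inr j)) (e₂ k)) D (X.submatrix e e)
    (fun j k => by simp [hD, he₁, he₂]) hDX hsum hT hθ
  rw [hDdet] at hmain
  have hlaw := hG.hasLaw_rows e₁ e₂
  refine le_trans ?_ hmain
  rw [← hlaw.map_eq]
  refine le_trans (le_of_eq ?_) (Measure.le_map_apply hlaw.aemeasurable _)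
  congr 1
  ext ω
  simp only [Set.mem_ofPred_eq, Set.mem_preimage]
  rw [← Matrix.norm_det_submatrix_equiv _ e₁ e₂]
  have : (B + (G ω).map Complex.ofReal).submatrix e₁ e₂ = Matrix.of (Sum.elim
      (realShift (fun j k => B (e₁ (Sum.inl j)) (e₂ k)) fun j k => G ω (e₁ (Sum.inl j)) (e₂ k))
      (realShift (fun j k => B (e₁ (Sum.inr j)) (e₂ k)) fun j k =>
        G ω (e₁ (Sum.inr j)) (e₂ k))) := by
    ext i j
    rcases i with i | i <;> simp [realShift]
  rw [this]

/-! ### Truncated Jordan blocks and the Frobenius norms of their inverses. -/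

/-- The Jordan block of size `n` and eigenvalue `w` without its first `d` columns and its last `d`
rows. -/
def truncatedBlock (n d : ℕ) (w : ℂ) : Matrix (Fin (n - d)) (Fin (n - d)) ℂ :=
  Matrix.of fun i j => if (i : ℕ) = j + d then w else if (i : ℕ) + 1 = j + d then 1 else 0

lemma det_truncatedBlock_zero (n : ℕ) (w : ℂ) : (truncatedBlock n 0 w).det = w ^ n := by
  rw [Matrix.det_of_isUpperTriangular]
  · simp [truncatedBlock]
  · intro i j hij
    have : (j : ℕ) < i := hij
    simp only [truncatedBlock, Matrix.of_apply]
    rw [if_neg (by omega), if_neg (by omega)]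

/-- The deletion moves the superdiagonal of ones onto the diagonal and `w` below it. -/
lemma det_truncatedBlock_one (n : ℕ) (w : ℂ) : (truncatedBlock n 1 w).det = 1 := by
  rw [Matrix.det_of_isLowerTriangular]
  · simp [truncatedBlock]
  · intro i j hij
    have : (i : ℕ) < j := hij
    simp only [truncatedBlock, Matrix.of_apply]
    rw [if_neg (by omega), if_neg (by omega)]

/-- The inverse is the finite Neumann series of `w (1 + w⁻¹ S)` for the nilpotent shift `S`. -/
lemma truncatedBlock_zero_mul (n : ℕ) {w : ℂ} (hw : w ≠ 0) :
    truncatedBlock n 0 w * (Matrix.of fun i j : Fin (n - 0) =>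
      if (i : ℕ) ≤ j then w⁻¹ * (-w⁻¹) ^ ((j : ℕ) - i) else 0) = 1 := by
  ext i k
  rw [Matrix.mul_apply]
  simp only [truncatedBlock, Matrix.of_apply, add_zero]
  have h0 : ∀ j : Fin (n - 0), (if (i : ℕ) = j then w else if (i : ℕ) + 1 = j then 1 else 0) =
      (if j = i then w else 0) + (if (i : ℕ) + 1 = j then (1 : ℂ) else 0) := by
    intro j
    by_cases h : j = i
    · simp [h]
    · have : ¬ (i : ℕ) = j := fun h' => h (Fin.ext h'.symm)
      simp [h, this]
  simp_rw [h0, add_mul]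
  rw [Finset.sum_add_distrib]
  simp only [ite_mul, zero_mul, one_mul, Finset.sum_ite_eq', Finset.mem_univ, if_true]
  by_cases hi : (i : ℕ) + 1 < n - 0
  · have h1 : ∀ j : Fin (n - 0), ((i : ℕ) + 1 = j) ↔ j = ⟨i + 1, hi⟩ := fun j => by
      rw [Fin.ext_iff]; exact eq_comm
    simp_rw [h1]
    simp only [Finset.sum_ite_eq', Finset.mem_univ, if_true]
    rcases lt_trichotomy (i : ℕ) k with h | h | h
    · rw [if_pos h.le, if_pos (Nat.succ_le_of_lt h), Matrix.one_apply_ne (by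
        intro h'; rw [h'] at h; exact lt_irrefl _ h)]
      obtain ⟨e, he⟩ : ∃ e, (k : ℕ) - i = e + 1 := ⟨k - i - 1, by omega⟩
      have he' : (k : ℕ) - (i + 1) = e := by omega
      rw [he, he', pow_succ]
      field_simp
      ring
    · rw [if_pos h.le, if_neg (by omega), Fin.ext h, Matrix.one_apply_eq]
      simp [hw]
    · rw [if_neg (by omega), if_neg (by omega), Matrix.one_apply_ne (by
        intro h'; rw [h'] at h; exact lt_irrefl _ h)]
      simp
  · have h1 : ∀ j : Fin (n - 0), ¬ ((i : ℕ) + 1 = j) := fun j h => hi (h ▸ j.2)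
    simp_rw [if_neg (h1 _)]
    have hk := k.2
    rcases lt_trichotomy (i : ℕ) k with h | h | h
    · omega
    · rw [if_pos h.le, Fin.ext h, Matrix.one_apply_eq]
      simp [hw]
    · rw [if_neg (by omega), Matrix.one_apply_ne (by
        intro h'; rw [h'] at h; exact lt_irrefl _ h)]
      simp

lemma truncatedBlock_one_mul (n : ℕ) (w : ℂ) :
    truncatedBlock n 1 w * (Matrix.of fun i j : Fin (n - 1) =>
      if (j : ℕ) ≤ i then (-w) ^ ((i : ℕ) - j) else 0) = 1 := by
  ext i k
  rw [Matrix.mul_apply]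
  simp only [truncatedBlock, Matrix.of_apply]
  have h0 : ∀ j : Fin (n - 1),
      (if (i : ℕ) = j + 1 then w else if (i : ℕ) + 1 = j + 1 then 1 else 0) =
      (if j = i then 1 else 0) + (if (i : ℕ) = j + 1 then w else 0) := by
    intro j
    by_cases h : j = i
    · simp [h]
    · have : ¬ (i : ℕ) = j := fun h' => h (Fin.ext h'.symm)
      simp [h, this]
  simp_rw [h0, add_mul]
  rw [Finset.sum_add_distrib]
  simp only [ite_mul, zero_mul, one_mul, Finset.sum_ite_eq', Finset.mem_univ, if_true]
  have hi2 := i.2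
  by_cases hi : (i : ℕ) = 0
  · have h1 : ∀ j : Fin (n - 1), ¬ ((i : ℕ) = j + 1) := fun j h => by omega
    simp_rw [if_neg (h1 _)]
    rcases lt_trichotomy (k : ℕ) i with h | h | h
    · omega
    · rw [if_pos h.le, ← Fin.ext h, Matrix.one_apply_eq]
      simp
    · rw [if_neg (by omega), Matrix.one_apply_ne (by
        intro h'; rw [h'] at h; exact lt_irrefl _ h)]
      simp
  · have h1 : ∀ j : Fin (n - 1), ((i : ℕ) = j + 1) ↔ j = ⟨i - 1, by omega⟩ := fun j => by
      rw [Fin.ext_iff]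
      constructor
      · intro h; simp only; omega
      · intro h; simp only at h; omega
    simp_rw [h1]
    simp only [Finset.sum_ite_eq', Finset.mem_univ, if_true]
    rcases lt_trichotomy (k : ℕ) i with h | h | h
    · rw [if_pos h.le, if_pos (by omega), Matrix.one_apply_ne (by
        intro h'; rw [h'] at h; exact lt_irrefl _ h)]
      obtain ⟨e, he⟩ : ∃ e, (i : ℕ) - k = e + 1 := ⟨i - k - 1, by omega⟩
      have he' : (i : ℕ) - 1 - k = e := by omega
      rw [he, he', pow_succ]
      ring
    · rw [if_pos h.le, if_neg (by omega), ← Fin.ext h, Matrix.one_apply_eq]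
      simp
    · rw [if_neg (by omega), if_neg (by omega), Matrix.one_apply_ne (by
        intro h'; rw [h'] at h; exact lt_irrefl _ h)]
      simp

lemma sum_fin_ite_pow_sub_le {r : ℝ} (hr : 0 ≤ r) {m n : ℕ} (hmn : m ≤ n) (k : ℕ) :
    ∑ i : Fin m, (if k ≤ (i : ℕ) then r ^ ((i : ℕ) - k) else 0) ≤ ∑ l ∈ Finset.range n, r ^ l := by
  rw [Fin.sum_univ_eq_sum_range (fun i => if k ≤ i then r ^ (i - k) else 0) m,
    ← Finset.sum_filter]
  have h1 : (Finset.range m).filter (fun i => k ≤ i) = Finset.Ico k m := by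
    ext i; simp [and_comm]
  rw [h1, Finset.sum_Ico_eq_sum_range]
  simp only [Nat.add_sub_cancel_left]
  exact Finset.sum_le_sum_of_subset_of_nonneg (Finset.range_mono (by omega))
    fun i _ _ => by positivity

lemma exists_truncatedBlock_one_mul_eq_one (n : ℕ) (w : ℂ) :
    ∃ X, truncatedBlock n 1 w * X = 1 ∧
      ∑ k, ∑ i, ‖X i k‖ ^ 2 ≤ n * ∑ l ∈ Finset.range n, (‖w‖ ^ 2) ^ l := by
  refine ⟨_, truncatedBlock_one_mul n w, ?_⟩
  have h1 : ∀ k : Fin (n - 1), ∑ i : Fin (n - 1), ‖(Matrix.of fun i j : Fin (n - 1) =>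
      if (j : ℕ) ≤ i then (-w) ^ ((i : ℕ) - j) else 0) i k‖ ^ 2 ≤
      ∑ l ∈ Finset.range n, (‖w‖ ^ 2) ^ l := by
    intro k
    refine le_trans (le_of_eq ?_) (sum_fin_ite_pow_sub_le (by positivity) (Nat.sub_le n 1) k)
    refine Finset.sum_congr rfl fun i _ => ?_
    simp only [Matrix.of_apply]
    split_ifs
    · rw [norm_pow, norm_neg, ← pow_mul, ← pow_mul, mul_comm]
    · simp
  refine (Finset.sum_le_sum fun k _ => h1 k).trans ?_
  rw [Finset.sum_const, Finset.card_univ, Fintype.card_fin, nsmul_eq_mul]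
  refine mul_le_mul_of_nonneg_right ?_ (Finset.sum_nonneg fun l _ => by positivity)
  exact_mod_cast Nat.sub_le n 1

lemma exists_truncatedBlock_zero_mul_eq_one (n : ℕ) {w : ℂ} (hw : w ≠ 0) :
    ∃ X, truncatedBlock n 0 w * X = 1 ∧
      ∑ k, ∑ i, ‖X i k‖ ^ 2 ≤
        n * ((‖w‖ ^ 2)⁻¹ * ∑ l ∈ Finset.range n, ((‖w‖ ^ 2)⁻¹) ^ l) := by
  refine ⟨_, truncatedBlock_zero_mul n hw, ?_⟩
  rw [Finset.sum_comm]
  have h1 : ∀ i : Fin (n - 0), ∑ k : Fin (n - 0), ‖(Matrix.of fun i j : Fin (n - 0) =>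
      if (i : ℕ) ≤ j then w⁻¹ * (-w⁻¹) ^ ((j : ℕ) - i) else 0) i k‖ ^ 2 ≤
      (‖w‖ ^ 2)⁻¹ * ∑ l ∈ Finset.range n, ((‖w‖ ^ 2)⁻¹) ^ l := by
    intro i
    refine le_trans (le_of_eq ?_) (mul_le_mul_of_nonneg_left
      (sum_fin_ite_pow_sub_le (by positivity) (Nat.sub_le n 0) i) (by positivity))
    rw [Finset.mul_sum]
    refine Finset.sum_congr rfl fun k _ => ?_
    simp only [Matrix.of_apply]
    split_ifs
    · rw [norm_mul, norm_pow, norm_neg, norm_inv, mul_pow, ← pow_mul, inv_pow, inv_pow, inv_pow,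
        ← pow_mul, mul_comm 2]
    · simp
  refine (Finset.sum_le_sum fun k _ => h1 k).trans ?_
  rw [Finset.sum_const, Finset.card_univ, Fintype.card_fin, nsmul_eq_mul]
  simp

lemma geom_sum_le_of_lt {r Q : ℝ} {n : ℕ} (hr0 : 0 ≤ r) (hr : r ≤ 1)
    (h : (n : ℝ) < Q ∨ (0 < 1 - r ∧ (1 - r)⁻¹ < Q)) :
    ∑ l ∈ Finset.range n, r ^ l ≤ Q := by
  rcases h with h | ⟨h1, h2⟩
  · refine le_trans ?_ h.le
    refine (Finset.sum_le_sum fun l _ => pow_le_one₀ hr0 hr).trans ?_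
    simp
  · refine le_trans ?_ h2.le
    rw [← tsum_geometric_of_lt_one hr0 (by linarith)]
    exact (summable_geometric_of_lt_one hr0 (by linarith)).sum_le_tsum _
      fun j _ => by positivity

open Classical in
/-- The number of rows and columns to delete from a block: one if the block has a singular value
that is negligible with respect to the noise, none otherwise. -/
noncomputable def deletion (n : ℕ) (x τ : ℝ) : ℕ :=
  if x < 1 ∧ x ^ n < n * τ then 1 else 0

/-- If `|w| < 1` and the block is truncated, the inverse has powers of `w` as entries; if `|w| ≥ 1`,
powers of `w⁻¹`. Both give geometric sums bounded by `Q`. For an untruncated block with `|w| < 1`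
the powers of `w⁻¹` grow, but `|w| ^ n ≥ n τ` keeps them under control, at the price of `(τ ^ 2)⁻¹`.
-/
lemma exists_truncatedBlock_mul_eq_one {n : ℕ} (hn : 0 < n) (w : ℂ) {Q τ : ℝ} (hτ : 0 < τ)
    (h : (n : ℝ) < Q ∨ (0 < |1 - ‖w‖ ^ 2| ∧ |1 - ‖w‖ ^ 2|⁻¹ < Q)) :
    ∃ X, truncatedBlock n (deletion n ‖w‖ τ) w * X = 1 ∧
      ∑ k, ∑ i, ‖X i k‖ ^ 2 ≤ n * Q + (τ ^ 2)⁻¹ := by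
  have hn' : (0 : ℝ) < n := by exact_mod_cast hn
  by_cases hw : ‖w‖ < 1
  · have hw2 : ‖w‖ ^ 2 < 1 := by nlinarith [norm_nonneg w]
    by_cases hd : ‖w‖ ^ n < n * τ
    · have : deletion n ‖w‖ τ = 1 := by rw [deletion, if_pos ⟨hw, hd⟩]
      rw [this]
      obtain ⟨X, hX, hX2⟩ := exists_truncatedBlock_one_mul_eq_one n w
      refine ⟨X, hX, hX2.trans ?_⟩
      rw [abs_of_pos (by linarith)] at h
      have h1 := geom_sum_le_of_lt (by positivity) hw2.le h
      have h2 : 0 ≤ (τ ^ 2)⁻¹ := by positivity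
      nlinarith
    · have : deletion n ‖w‖ τ = 0 := by rw [deletion, if_neg fun h => hd h.2]
      rw [this]
      rw [not_lt] at hd
      have hw0 : 0 < ‖w‖ := by
        rcases eq_or_lt_of_le (norm_nonneg w) with h0 | h0
        · rw [← h0, zero_pow hn.ne'] at hd
          nlinarith
        · exact h0
      obtain ⟨X, hX, hX2⟩ := exists_truncatedBlock_zero_mul_eq_one n (norm_pos_iff.1 hw0)
      refine ⟨X, hX, hX2.trans ?_⟩
      have hρ : 1 ≤ (‖w‖ ^ 2)⁻¹ := (one_le_inv₀ (by positivity)).2 hw2.le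
      have hQ : 0 ≤ (n : ℝ) * Q := by
        rcases h with h | h
        · nlinarith
        · have := inv_pos.2 h.1
          nlinarith [h.2]
      -- Crude bound by `n` times the largest term. The two factors `n` that arise cancel the `n ^
      -- 2` coming from the threshold `n τ`, which is why the threshold is not merely `τ`.
      have h1 : (‖w‖ ^ 2)⁻¹ * ∑ l ∈ Finset.range n, ((‖w‖ ^ 2)⁻¹) ^ l ≤ n * ((‖w‖ ^ 2)⁻¹) ^ n := by
        rw [Finset.mul_sum]
        refine (Finset.sum_le_card_nsmul (Finset.range n) _ (((‖w‖ ^ 2)⁻¹) ^ n) fun l hl => ?_).trans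
          (by simp)
        rw [← pow_succ']
        exact pow_le_pow_right₀ hρ (Finset.mem_range.1 hl)
      have h2 : ((‖w‖ ^ 2)⁻¹) ^ n ≤ ((n * τ) ^ 2)⁻¹ := by
        rw [inv_pow, ← pow_mul, mul_comm 2 n, pow_mul]
        gcongr
      have h3 : (n : ℝ) * (n * ((n * τ) ^ 2)⁻¹) = (τ ^ 2)⁻¹ := by
        field_simp
      calc (n : ℝ) * ((‖w‖ ^ 2)⁻¹ * ∑ l ∈ Finset.range n, ((‖w‖ ^ 2)⁻¹) ^ l)
          ≤ n * (n * ((n * τ) ^ 2)⁻¹) := by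
            refine mul_le_mul_of_nonneg_left (h1.trans ?_) hn'.le
            exact mul_le_mul_of_nonneg_left h2 hn'.le
        _ ≤ _ := by rw [h3]; linarith
  · have : deletion n ‖w‖ τ = 0 := by rw [deletion, if_neg fun h => hw h.1]
    rw [this]
    rw [not_lt] at hw
    have hw2 : 1 ≤ ‖w‖ ^ 2 := one_le_pow₀ hw
    obtain ⟨X, hX, hX2⟩ := exists_truncatedBlock_zero_mul_eq_one n
      (norm_pos_iff.1 (by linarith))
    refine ⟨X, hX, hX2.trans ?_⟩
    have hρ : (‖w‖ ^ 2)⁻¹ ≤ 1 := inv_le_one_of_one_le₀ hw2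
    have hρ0 : 0 < (‖w‖ ^ 2)⁻¹ := by positivity
    have h1 : (‖w‖ ^ 2)⁻¹ * ∑ l ∈ Finset.range n, ((‖w‖ ^ 2)⁻¹) ^ l ≤ Q := by
      rcases h with h | h
      · have := geom_sum_le_of_lt hρ0.le hρ (Or.inl h)
        have h0 : 0 ≤ ∑ l ∈ Finset.range n, ((‖w‖ ^ 2)⁻¹) ^ l :=
          Finset.sum_nonneg fun l _ => by positivity
        nlinarith
      · rw [abs_of_nonpos (by linarith)] at h
        have hlt : (‖w‖ ^ 2)⁻¹ < 1 := inv_lt_one_of_one_lt₀ (by linarith [h.1])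
        have h3 : ∑ l ∈ Finset.range n, ((‖w‖ ^ 2)⁻¹) ^ l ≤ (1 - (‖w‖ ^ 2)⁻¹)⁻¹ := by
          rw [← tsum_geometric_of_lt_one hρ0.le hlt]
          exact (summable_geometric_of_lt_one hρ0.le hlt).sum_le_tsum _
            fun j _ => by positivity
        refine (mul_le_mul_of_nonneg_left h3 hρ0.le).trans ?_
        have h4 : (‖w‖ ^ 2)⁻¹ * (1 - (‖w‖ ^ 2)⁻¹)⁻¹ = (-(1 - ‖w‖ ^ 2))⁻¹ := by
          rw [← mul_inv]
          congr 1
          field_simp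
          ring
        rw [h4]
        exact h.2.le
    have h2 : 0 ≤ (τ ^ 2)⁻¹ := by positivity
    nlinarith

lemma deletion_le_one (n : ℕ) (x τ : ℝ) : deletion n x τ ≤ 1 := by
  unfold deletion
  split_ifs <;> simp

/-! ### Assembling the blocks and estimating the characteristic determinant. -/

lemma blockDiagonal'_frobenius {o : Type*} [Fintype o] [DecidableEq o] {m : o → Type*}
    [∀ i, Fintype (m i)] [∀ i, DecidableEq (m i)] (X : ∀ i, Matrix (m i) (m i) ℂ) :
    ∑ k, ∑ i, ‖Matrix.blockDiagonal' X i k‖ ^ 2 = ∑ l, ∑ k, ∑ i, ‖X l i k‖ ^ 2 := by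
  rw [Fintype.sum_sigma]
  refine Finset.sum_congr rfl fun l _ => Finset.sum_congr rfl fun k _ => ?_
  rw [Fintype.sum_sigma, Finset.sum_eq_single l]
  · simp [Matrix.blockDiagonal'_apply_eq]
  · intro l' _ hl
    refine Finset.sum_eq_zero fun i _ => ?_
    rw [Matrix.blockDiagonal'_apply_ne _ _ _ hl]
    simp
  · simp

lemma det_blockDiagonal'_fin {k : ℕ} {m : Fin k → Type*} [∀ i, Fintype (m i)]
    [∀ i, DecidableEq (m i)] (A : ∀ i, Matrix (m i) (m i) ℂ) :
    (Matrix.blockDiagonal' A).det = ∏ i, (A i).det := by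
  rw [(Matrix.blockTriangular_blockDiagonal' A).det_fintype]
  refine Finset.prod_congr rfl fun i _ => ?_
  rw [← Matrix.det_submatrix_equiv_self (Equiv.sigmaSubtype i).symm]
  congr 1
  ext x y
  simp [Matrix.toSquareBlock, Matrix.toSquareBlockProp, Equiv.sigmaSubtype,
    Matrix.blockDiagonal'_apply_eq]

/-- The embedding of the truncated blocks into the index set of the full matrix, with a shift by
`e i` in the `i`-th block. -/
def blockEmb {N : ℕ} (b : Composition N) (d e : Fin b.length → ℕ)
    (he : ∀ i, e i ≤ d i) (p : Σ i, Fin (b.blocksFun i - d i)) : Fin N :=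
  b.blocksFinEquiv ⟨p.1, ⟨p.2 + e p.1, by have := p.2.2; have := he p.1; omega⟩⟩

lemma blockEmb_injective {N : ℕ} (b : Composition N) (d e : Fin b.length → ℕ)
    (he : ∀ i, e i ≤ d i) : Function.Injective (blockEmb b d e he) := by
  rintro ⟨i, j⟩ ⟨i', j'⟩ h
  have h1 := b.blocksFinEquiv.injective h
  rw [Sigma.mk.injEq] at h1
  obtain ⟨rfl, h2⟩ := h1
  have h3 := eq_of_heq h2
  rw [Fin.mk.injEq] at h3
  have : j = j' := Fin.ext (Nat.add_right_cancel h3)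
  rw [this]

lemma jordanMatrix_sub_submatrix {N : ℕ} (b : Composition N) (c : Fin b.length → ℂ) (z : ℂ)
    (d : Fin b.length → ℕ) :
    (jordanMatrix b c - z • (1 : Matrix (Fin N) (Fin N) ℂ)).submatrix
        (blockEmb b d (fun _ => 0) fun _ => Nat.zero_le _) (blockEmb b d d fun _ => le_rfl) =
      Matrix.blockDiagonal' fun i => truncatedBlock (b.blocksFun i) (d i) (c i - z) := by
  ext ⟨i, j⟩ ⟨i', j'⟩
  simp only [Matrix.submatrix_apply, Matrix.sub_apply, jordanMatrix, Matrix.reindex_apply, blockEmb,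
    Equiv.symm_apply_apply, Matrix.smul_apply, Matrix.one_apply, EmbeddingLike.apply_eq_iff_eq]
  by_cases hi : i = i'
  · subst hi
    simp only [Matrix.blockDiagonal'_apply_eq, jordanBlock, truncatedBlock, Matrix.of_apply,
      Sigma.mk.injEq, heq_eq_eq, true_and, Fin.mk.injEq, add_zero]
    by_cases h1 : (j : ℕ) = j' + d i
    · simp [h1]
    · by_cases h2 : (j : ℕ) + 1 = j' + d i <;> simp [h1, h2]
  · rw [Matrix.blockDiagonal'_apply_ne _ _ _ hi, Matrix.blockDiagonal'_apply_ne _ _ _ hi]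
    simp [hi]

lemma card_truncated_add_sum {N : ℕ} (b : Composition N) (d : Fin b.length → ℕ)
    (hd : ∀ i, d i ≤ 1) :
    Fintype.card (Σ i, Fin (b.blocksFun i - d i)) + ∑ i, d i = N := by
  rw [Fintype.card_sigma, ← Finset.sum_add_distrib]
  simp only [Fintype.card_fin]
  refine Eq.trans ?_ b.sum_blocksFun
  refine Finset.sum_congr rfl fun i _ => ?_
  have h1 := hd i
  have h2 : 0 < b.blocksFun i := Nat.lt_of_lt_of_le Nat.zero_lt_one (b.one_le_blocksFun i)
  omega

lemma lt_or_inv_lt_of_min_lt {n : ℕ} {x Q : ℝ}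
    (h : min (n : ℝ≥0∞) (ENNReal.ofReal x)⁻¹ < ENNReal.ofReal Q) :
    (n : ℝ) < Q ∨ (0 < x ∧ x⁻¹ < Q) := by
  rcases min_lt_iff.1 h with h | h
  · left
    rw [← ENNReal.ofReal_natCast] at h
    exact (ENNReal.ofReal_lt_ofReal_iff_of_nonneg (by positivity)).1 h
  · right
    have hx : 0 < x := by
      by_contra hx
      rw [ENNReal.ofReal_of_nonpos (not_lt.1 hx)] at h
      simp at h
    rw [← ENNReal.ofReal_inv_of_pos hx] at h
    exact ⟨hx, (ENNReal.ofReal_lt_ofReal_iff_of_nonneg (by positivity)).1 h⟩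

/-- Small ball estimate for `det (M + N ^ (-γ) G - z)`. -/
lemma measure_norm_det_perturbedMatrix_le {Ω : Type*} [MeasurableSpace Ω] {P : Measure Ω}
    [IsProbabilityMeasure P] {N : ℕ} (hN : 0 < N) {γ ε : ℝ} (b : Composition N)
    (c : Fin b.length → ℂ) {G : Ω → Matrix (Fin N) (Fin N) ℝ} (hG : IsStandardGaussianMatrix P G)
    {z : ℂ} (hz : z ∈ stableSet γ ε b c) {d : Fin b.length → ℕ}
    (hd : ∀ i, d i = deletion (b.blocksFun i) ‖c i - z‖ ((N : ℝ) ^ (1 / 2 - γ))) {T θ : ℝ}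
    (hTd : T = (N : ℝ) ^ (-ε) + b.length / N) (hT : 4 * T < 1) (hθ : 0 < θ) :
    P {ω | ‖(perturbedMatrix γ (jordanMatrix b c) (G ω) - z • 1).det‖ ≤
        2⁻¹ * (((N : ℝ) ^ (-γ)) ^ (∑ i, d i) *
          ∏ i, ‖(truncatedBlock (b.blocksFun i) (d i) (c i - z)).det‖) *
            √(∑ i, d i).factorial * θ} ≤
      4 * ENNReal.ofReal (4 * T / (1 - 4 * T)) + 6 ^ (∑ i, d i) * ENNReal.ofReal (√θ) := by
  have hN' : (0 : ℝ) < N := by exact_mod_cast hN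
  set σ : ℝ := (N : ℝ) ^ (-γ) with hσ
  have hσ0 : 0 < σ := Real.rpow_pos_of_pos hN' _
  have hσc : (σ : ℂ) ≠ 0 := by exact_mod_cast hσ0.ne'
  set s := ∑ i, d i with hs
  have hd1 : ∀ i, d i ≤ 1 := fun i => hd i ▸ deletion_le_one _ _ _
  have hcard := card_truncated_add_sum b d hd1
  set Q : ℝ := (N : ℝ) ^ (2 * γ - 1 - ε) with hQ
  set τ : ℝ := (N : ℝ) ^ (1 / 2 - γ) with hτ
  have hτ0 : 0 < τ := Real.rpow_pos_of_pos hN' _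
  have hX : ∀ i, ∃ X, truncatedBlock (b.blocksFun i) (d i) (c i - z) * X = 1 ∧
      ∑ k, ∑ j, ‖X j k‖ ^ 2 ≤ b.blocksFun i * Q + (τ ^ 2)⁻¹ := by
    intro i
    rw [hd i]
    refine exists_truncatedBlock_mul_eq_one
      (Nat.lt_of_lt_of_le Nat.zero_lt_one (b.one_le_blocksFun i)) _ hτ0 ?_
    have := lt_or_inv_lt_of_min_lt (hz i)
    rwa [norm_sub_rev] at this
  choose X hXm hXn using hX
  set A : Matrix (Fin N) (Fin N) ℂ := jordanMatrix b c - z • 1 with hA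
  set B : Matrix (Fin N) (Fin N) ℂ := (σ : ℂ)⁻¹ • A with hB
  set ρ := blockEmb b d (fun _ => 0) fun _ => Nat.zero_le _ with hρ
  set χ := blockEmb b d d fun _ => le_rfl with hχ
  have hsub : B.submatrix ρ χ = (σ : ℂ)⁻¹ •
      Matrix.blockDiagonal' fun i => truncatedBlock (b.blocksFun i) (d i) (c i - z) := by
    rw [← jordanMatrix_sub_submatrix]
    rfl
  have hBX : B.submatrix ρ χ * ((σ : ℂ) • Matrix.blockDiagonal' X) = 1 := by
    rw [hsub, Matrix.smul_mul, Matrix.mul_smul, smul_smul, inv_mul_cancel₀ hσc, one_smul,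
      ← Matrix.blockDiagonal'_mul]
    simp_rw [hXm]
    exact Matrix.blockDiagonal'_one
  set t : ℝ := ∑ k, ∑ i, ‖((σ : ℂ) • Matrix.blockDiagonal' X) i k‖ ^ 2 with ht
  have htT : t ≤ T := by
    have h1 : t = σ ^ 2 * ∑ l, ∑ k, ∑ i, ‖X l i k‖ ^ 2 := by
      rw [← blockDiagonal'_frobenius, Finset.mul_sum]
      refine Finset.sum_congr rfl fun k _ => ?_
      rw [Finset.mul_sum]
      refine Finset.sum_congr rfl fun i _ => ?_
      rw [Matrix.smul_apply, norm_smul, mul_pow, Complex.norm_real, Real.norm_eq_abs, sq_abs]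
    have h2 : ∑ l, ∑ k, ∑ i, ‖X l i k‖ ^ 2 ≤ N * Q + b.length * (τ ^ 2)⁻¹ := by
      refine (Finset.sum_le_sum fun l _ => hXn l).trans (le_of_eq ?_)
      rw [Finset.sum_add_distrib, ← Finset.sum_mul]
      have : ∑ i, (b.blocksFun i : ℝ) = N := by exact_mod_cast b.sum_blocksFun
      rw [this]
      simp
    -- The exponents `-2γ + 1 + (2γ - 1 - ε) = -ε` here and `-2γ - 2 (1/2 - γ) = -1` in `h4` produce
    -- the two summands of `T`.
    have h3 : σ ^ 2 * (N * Q) = (N : ℝ) ^ (-ε) := by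
      rw [hσ, hQ, ← Real.rpow_natCast, ← Real.rpow_mul hN'.le]
      nth_rewrite 2 [← Real.rpow_one (N : ℝ)]
      rw [← Real.rpow_add hN', ← Real.rpow_add hN']
      congr 1
      push_cast
      ring
    have h4 : σ ^ 2 * (τ ^ 2)⁻¹ = (N : ℝ)⁻¹ := by
      rw [hσ, hτ, ← Real.rpow_natCast, ← Real.rpow_natCast, ← Real.rpow_mul hN'.le,
        ← Real.rpow_mul hN'.le, ← Real.rpow_neg hN'.le, ← Real.rpow_add hN', ← Real.rpow_neg_one]
      congr 1
      push_cast
      ring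
    rw [h1, hTd]
    refine (mul_le_mul_of_nonneg_left h2 (by positivity)).trans (le_of_eq ?_)
    rw [mul_add, h3, mul_left_comm, h4, div_eq_mul_inv]
  have ht0 : 0 ≤ t := Finset.sum_nonneg fun k _ => Finset.sum_nonneg fun i _ => by positivity
  have hmain := hG.measure_norm_det_le B hcard ρ χ (blockEmb_injective _ _ _ _)
    (blockEmb_injective _ _ _ _) _ hBX ht.symm (by linarith) hθ
  refine le_trans (le_trans (measure_mono ?_) hmain) ?_
  · intro ω hω
    simp only [Set.mem_ofPred_eq] at hω ⊢
    have h1 : perturbedMatrix γ (jordanMatrix b c) (G ω) - z • 1 =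
        (σ : ℂ) • (B + (G ω).map Complex.ofReal) := by
      rw [hB, smul_add, smul_smul, mul_inv_cancel₀ hσc, one_smul, perturbedMatrix, hA]
      abel
    rw [h1, Matrix.det_smul, norm_mul, norm_pow, Complex.norm_real, Real.norm_eq_abs,
      abs_of_pos hσ0, Fintype.card_fin] at hω
    rw [hsub, Matrix.det_smul, det_blockDiagonal'_fin, norm_mul, norm_pow, norm_inv,
      Complex.norm_real, Real.norm_eq_abs, abs_of_pos hσ0, norm_prod]
    -- Of the `N` factors `σ` taken out of the full determinant, all but `s` are matched by the
    -- normalisation of the submatrix.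
    have h2 : σ ^ N = σ ^ Fintype.card (Σ i, Fin (b.blocksFun i - d i)) * σ ^ s := by
      rw [← pow_add, hcard]
    rw [h2] at hω
    set K := Fintype.card (Σ i, Fin (b.blocksFun i - d i))
    set p := ∏ i, ‖(truncatedBlock (b.blocksFun i) (d i) (c i - z)).det‖
    rw [inv_pow]
    have h3 : 0 < σ ^ K := by positivity
    have h4 : 0 < σ ^ s := by positivity
    have h5 : 2⁻¹ * ((σ ^ K)⁻¹ * p) * √s.factorial * θ =
        (2⁻¹ * (σ ^ s * p) * √s.factorial * θ) / (σ ^ K * σ ^ s) := by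
      field_simp
    rw [h5, le_div_iff₀ (by positivity), mul_comm]
    exact hω
  · refine add_le_add_left (mul_le_mul_right (ENNReal.ofReal_le_ofReal ?_) _) _
    rw [div_le_div_iff₀ (by linarith) (by linarith)]
    nlinarith

/-! ### Logarithmic potentials of the spectrum and of the circle mixture. -/

lemma log_enorm_of_ne_zero {w : ℂ} (hw : w ≠ 0) :
    ENNReal.log ‖w‖ₑ = ((Real.log ‖w‖ : ℝ) : EReal) := by
  rw [← ofReal_norm, ENNReal.log_ofReal_of_pos (norm_pos_iff.2 hw)]

lemma toENNReal_log_enorm (w : ℂ) :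
    (ENNReal.log ‖w‖ₑ).toENNReal = ENNReal.ofReal (Real.log ‖w‖) := by
  by_cases hw : w = 0
  · simp [hw]
  · rw [log_enorm_of_ne_zero hw, EReal.toENNReal_of_ne_top (EReal.coe_ne_top _)]
    simp

lemma toENNReal_neg_log_enorm {w : ℂ} (hw : w ≠ 0) :
    (-ENNReal.log ‖w‖ₑ).toENNReal = ENNReal.ofReal (-Real.log ‖w‖) := by
  rw [log_enorm_of_ne_zero hw, ← EReal.coe_neg, EReal.toENNReal_of_ne_top (EReal.coe_ne_top _)]
  simp

lemma coe_integral_log_eq {ρ : Measure ℂ} {z : ℂ}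
    (h : Integrable (fun x => Real.log ‖z - x‖) ρ) :
    ((∫ x, Real.log ‖z - x‖ ∂ρ : ℝ) : EReal) =
      ((∫⁻ x, ENNReal.ofReal (Real.log ‖z - x‖) ∂ρ : ℝ≥0∞) : EReal) -
        ((∫⁻ x, ENNReal.ofReal (-Real.log ‖z - x‖) ∂ρ : ℝ≥0∞) : EReal) := by
  have h1 := h.lintegral_lt_top.ne
  have h2 := h.neg.lintegral_lt_top.ne
  simp only [Pi.neg_apply] at h2
  rw [integral_eq_lintegral_pos_part_sub_lintegral_neg_part h, EReal.coe_sub,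
    EReal.coe_ennreal_toReal h1, EReal.coe_ennreal_toReal h2]

/-- Only an inequality, because `Real.log 0 = 0`: an atom at `z` contributes `-∞` to the potential
and nothing to the real integral. -/
lemma logPotential_le_integral {ρ : Measure ℂ} {z : ℂ}
    (h : Integrable (fun x => Real.log ‖z - x‖) ρ) :
    logPotential ρ z ≤ ((∫ x, Real.log ‖z - x‖ ∂ρ : ℝ) : EReal) := by
  rw [coe_integral_log_eq h, logPotential]
  simp_rw [toENNReal_log_enorm]
  refine EReal.sub_le_sub le_rfl (EReal.coe_ennreal_le_coe_ennreal_iff.2 (lintegral_mono fun x => ?_))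
  by_cases hx : z - x = 0
  · simp [hx]
  · rw [toENNReal_neg_log_enorm hx]

lemma logPotential_eq_integral {ρ : Measure ℂ} {z : ℂ}
    (h : Integrable (fun x => Real.log ‖z - x‖) ρ) (hz : ∀ᵐ x ∂ρ, x ≠ z) :
    logPotential ρ z = ((∫ x, Real.log ‖z - x‖ ∂ρ : ℝ) : EReal) := by
  rw [coe_integral_log_eq h, logPotential]
  simp_rw [toENNReal_log_enorm]
  congr 2
  refine lintegral_congr_ae ?_
  filter_upwards [hz] with x hx
  rw [toENNReal_neg_log_enorm (sub_ne_zero.2 hx.symm)]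

lemma integrable_multiset_sum_dirac (s : Multiset ℂ) (f : ℂ → ℝ) :
    Integrable f (s.map fun w => Measure.dirac w).sum ∧
      ∫ x, f x ∂(s.map fun w => Measure.dirac w).sum = (s.map f).sum := by
  induction s using Multiset.induction_on with
  | empty => simp
  | cons a s ih =>
    have h1 : Integrable f (Measure.dirac a) := integrable_dirac (by simp)
    rw [Multiset.map_cons, Multiset.sum_cons, Multiset.map_cons, Multiset.sum_cons]
    exact ⟨h1.add_measure ih.1, by rw [integral_add_measure h1 ih.1, ih.2, integral_dirac]⟩

lemma ae_multiset_sum_dirac (s : Multiset ℂ) {p : ℂ → Prop} (hp : ∀ w ∈ s, p w) :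
    ∀ᵐ x ∂(s.map fun w => Measure.dirac w).sum, p x := by
  induction s using Multiset.induction_on with
  | empty => simp
  | cons a s ih =>
    rw [Multiset.map_cons, Multiset.sum_cons, ae_add_measure_iff]
    refine ⟨?_, ih fun w hw => hp w (Multiset.mem_cons_of_mem hw)⟩
    rw [ae_dirac_eq]
    exact hp a (Multiset.mem_cons_self a s)

lemma sum_log_norm_sub_eq (s : Multiset ℂ) {z : ℂ} (h : ∀ w ∈ s, w ≠ z) :
    (s.map fun w => Real.log ‖z - w‖).sum = Real.log ‖(s.map fun w => z - w).prod‖ := by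
  induction s using Multiset.induction_on with
  | empty => simp
  | cons a s ih =>
    have ha : z - a ≠ 0 := sub_ne_zero.2 (h a (Multiset.mem_cons_self a s)).symm
    have hs : ∀ w ∈ s, w ≠ z := fun w hw => h w (Multiset.mem_cons_of_mem hw)
    have hp : (s.map fun w => z - w).prod ≠ 0 := by
      refine Multiset.prod_ne_zero fun h0 => ?_
      obtain ⟨w, hw, hw0⟩ := Multiset.mem_map.1 h0
      exact hs w hw (sub_eq_zero.1 hw0).symm
    simp only [Multiset.map_cons, Multiset.sum_cons, Multiset.prod_cons, norm_mul]
    rw [Real.log_mul (norm_ne_zero_iff.2 ha) (norm_ne_zero_iff.2 hp), ih hs]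

/-- The logarithmic potential of the empirical spectral measure, off the spectrum. -/
lemma logPotential_empiricalSpectralMeasure {N : ℕ} (hN : N ≠ 0) (A : Matrix (Fin N) (Fin N) ℂ)
    (z : ℂ) (hdet : (A - z • 1).det ≠ 0) :
    logPotential (empiricalSpectralMeasure A) z =
      (((N : ℝ)⁻¹ * Real.log ‖(A - z • 1).det‖ : ℝ) : EReal) := by
  have heval : A.charpoly.eval z = (A.charpoly.roots.map fun w => z - w).prod := by
    have h1 := IsAlgClosed.splits A.charpoly
    conv_lhs => rw [h1.eq_prod_roots_of_monic A.charpoly_monic]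
    rw [Polynomial.eval_multiset_prod, Multiset.map_map]
    simp
  have hnorm : ‖(A - z • 1).det‖ = ‖A.charpoly.eval z‖ := by
    rw [Matrix.eval_charpoly, ← neg_sub, Matrix.det_neg, norm_mul, norm_pow, norm_neg, norm_one,
      one_pow, one_mul, Matrix.smul_one_eq_diagonal]
    rfl
  have hroot : ∀ w ∈ A.charpoly.roots, w ≠ z := by
    intro w hw h
    rw [h, Polynomial.mem_roots A.charpoly_monic.ne_zero, Polynomial.IsRoot] at hw
    rw [hw, norm_zero, norm_eq_zero] at hnorm
    exact hdet hnorm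
  obtain ⟨h1, h2⟩ := integrable_multiset_sum_dirac A.charpoly.roots fun x => Real.log ‖z - x‖
  have hN' : (N : ℝ≥0∞)⁻¹ ≠ ⊤ := by simp [hN]
  rw [empiricalSpectralMeasure, logPotential_eq_integral (h1.smul_measure hN')
    (Measure.ae_smul_measure (ae_multiset_sum_dirac _ hroot) _)]
  rw [integral_smul_measure, h2, hnorm, heval]
  congr 1
  rw [ENNReal.toReal_inv, ENNReal.toReal_natCast, smul_eq_mul]
  congr 1
  exact sum_log_norm_sub_eq _ hroot

/-- Jensen's formula for the circle; the right side is `log (max r |z - c|)`. -/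
lemma integrable_log_uniformCircle (c z : ℂ) {r : ℝ} (hr : 0 < r) :
    Integrable (fun x => Real.log ‖z - x‖) (uniformCircle c r) ∧
      ∫ x, Real.log ‖z - x‖ ∂(uniformCircle c r) =
        Real.log r + Real.posLog (r⁻¹ * ‖z - c‖) := by
  have hm : Measurable fun x : ℂ => Real.log ‖z - x‖ := by fun_prop
  have hcm : Measurable (circleMap c r) := (continuous_circleMap c r).measurable
  have h1 := circleIntegrable_log_norm_sub_const (a := z) (c := c) r
  rw [CircleIntegrable, intervalIntegrable_iff_integrableOn_Ioc_of_le Real.two_pi_pos.le] at h1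
  simp_rw [norm_sub_rev _ z] at h1
  have hc : (ENNReal.ofReal (2 * Real.pi))⁻¹ ≠ ⊤ := by simp [Real.pi_pos]
  have h2 := circleAverage_log_norm_sub_const_eq_log_radius_add_posLog (a := z) (c := c) hr.ne'
  rw [Real.circleAverage_def, intervalIntegral.integral_of_le Real.two_pi_pos.le] at h2
  simp_rw [norm_sub_rev _ z] at h2
  constructor
  · rw [uniformCircle, integrable_map_measure hm.aestronglyMeasurable hcm.aemeasurable]
    exact Integrable.smul_measure h1 hc
  · rw [uniformCircle, integral_map hcm.aemeasurable hm.aestronglyMeasurable,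
      integral_smul_measure, ← h2, ENNReal.toReal_inv, ENNReal.toReal_ofReal Real.two_pi_pos.le]

/-- An upper bound for the logarithmic potential of a mixture of circles. -/
lemma logPotential_circleMixture_le {N : ℕ} (hN : 1 < N) (γ : ℝ) (b : Composition N)
    (c : Fin b.length → ℂ) (z : ℂ) :
    logPotential (circleMixture γ b c) z ≤
      (((N : ℝ)⁻¹ * ∑ i, Real.log (max ((N : ℝ) ^ (1 / 2 - γ)) (‖c i - z‖ ^ b.blocksFun i)) : ℝ) :
        EReal) := by
  have hN' : (0 : ℝ) < N := by positivity
  have hr : ∀ i, 0 < blockRadius γ b i := fun i => Real.exp_pos _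
  have hintegrable : ∀ i, Integrable (fun x => Real.log ‖z - x‖)
      (((b.blocksFun i : ℝ≥0∞) / (N : ℝ≥0∞)) • uniformCircle (c i) (blockRadius γ b i)) := by
    intro i
    refine (integrable_log_uniformCircle (c i) z (hr i)).1.smul_measure ?_
    exact ENNReal.div_ne_top (by simp) (by simp; omega)
  have hsum : Integrable (fun x => Real.log ‖z - x‖) (circleMixture γ b c) :=
    integrable_finsetSum_measure.2 fun i _ => hintegrable i
  refine (logPotential_le_integral hsum).trans (le_of_eq ?_)
  congr 1
  rw [circleMixture, integral_finsetSum_measure fun i _ => hintegrable i, Finset.mul_sum]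
  refine Finset.sum_congr rfl fun i _ => ?_
  rw [integral_smul_measure, (integrable_log_uniformCircle (c i) z (hr i)).2, ENNReal.toReal_div,
    ENNReal.toReal_natCast, ENNReal.toReal_natCast, smul_eq_mul, norm_sub_rev z]
  set n := b.blocksFun i with hn
  have hn0 : n ≠ 0 := (Nat.lt_of_lt_of_le Nat.zero_lt_one (b.one_le_blocksFun i)).ne'
  have hn0' : (n : ℝ) ≠ 0 := by exact_mod_cast hn0
  -- The radius is chosen for this identity: `r_i ^ n_i = exp ((1/2 - γ) log N)`, since `a_i = n_i /
  -- log N`. It needs `log N ≠ 0`.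
  have hrn : blockRadius γ b i ^ n = (N : ℝ) ^ (1 / 2 - γ) := by
    have hlog : Real.log N ≠ 0 := (Real.log_pos (by exact_mod_cast hN)).ne'
    rw [blockRadius, blockRatio, ← hn, ← Real.exp_nat_mul, Real.rpow_def_of_pos hN']
    congr 1
    field_simp
    ring
  have hmax : Real.log (blockRadius γ b i) + Real.posLog ((blockRadius γ b i)⁻¹ * ‖c i - z‖) =
      Real.log (max (blockRadius γ b i) ‖c i - z‖) := by
    set r := blockRadius γ b i
    have hr0 : 0 < r := hr i
    rw [Real.posLog_eq_log_max_one (by positivity), ← Real.log_mul hr0.ne' (by positivity),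
      mul_max_of_nonneg _ _ hr0.le, mul_one, mul_inv_cancel_left₀ hr0.ne']
  rw [hmax, ← hrn]
  have hpow : max (blockRadius γ b i ^ n) (‖c i - z‖ ^ n) = max (blockRadius γ b i) ‖c i - z‖ ^ n := by
    rcases le_total (blockRadius γ b i) ‖c i - z‖ with h | h
    · rw [max_eq_right h, max_eq_right (pow_le_pow_left₀ (hr i).le h n)]
    · rw [max_eq_left h, max_eq_left (pow_le_pow_left₀ (norm_nonneg _) h n)]
  rw [hpow, Real.log_pow]
  ring

/-- A small value of the logarithmic potential of the empirical spectral measure forces a small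
characteristic determinant. -/
lemma norm_det_le_of_logPotential_le {N : ℕ} (hN : 1 < N) {γ δ : ℝ} (b : Composition N)
    (c : Fin b.length → ℂ) (A : Matrix (Fin N) (Fin N) ℂ) {z : ℂ}
    (h : logPotential (empiricalSpectralMeasure A) z ≤
      logPotential (circleMixture γ b c) z - (δ : EReal)) :
    ‖(A - z • 1).det‖ ≤ Real.exp (-(δ * N)) *
      ∏ i, max ((N : ℝ) ^ (1 / 2 - γ)) (‖c i - z‖ ^ b.blocksFun i) := by
  have hN' : (0 : ℝ) < N := by positivity
  have hpos : ∀ i, 0 < max ((N : ℝ) ^ (1 / 2 - γ)) (‖c i - z‖ ^ b.blocksFun i) := fun i =>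
    lt_max_of_lt_left (by positivity)
  -- Negating the bound makes the determinant nonzero, which the formula for the potential as `log
  -- |det|` requires.
  by_contra! hlt
  have hprod : 0 < ∏ i, max ((N : ℝ) ^ (1 / 2 - γ)) (‖c i - z‖ ^ b.blocksFun i) :=
    Finset.prod_pos fun i _ => hpos i
  have hdet : 0 < ‖(A - z • 1).det‖ := lt_of_le_of_lt (by positivity) hlt
  rw [logPotential_empiricalSpectralMeasure (by omega) A z (norm_pos_iff.1 hdet)] at h
  have h2 := h.trans (EReal.sub_le_sub (logPotential_circleMixture_le hN γ b c z) le_rfl)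
  rw [← EReal.coe_sub, EReal.coe_le_coe_iff] at h2
  have h3 := Real.log_lt_log (by positivity) hlt
  rw [Real.log_mul (Real.exp_pos _).ne' hprod.ne', Real.log_exp,
    Real.log_prod fun i _ => (hpos i).ne'] at h3
  have h4 := mul_le_mul_of_nonneg_left h2 hN'.le
  rw [mul_sub, mul_inv_cancel_left₀ hN'.ne', mul_inv_cancel_left₀ hN'.ne'] at h4
  linarith

/-! ### Deterministic comparison of the block sizes with the main term. -/

/-- The size of a block, up to a factor polynomial in its dimension, is attained by the truncated
block. -/
lemma max_le_norm_det_truncatedBlock {n : ℕ} (hn : 0 < n) {τ : ℝ} (hτ0 : 0 < τ) (hτ1 : τ ≤ 1)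
    (w : ℂ) :
    max τ (‖w‖ ^ n) ≤ ‖(truncatedBlock n (deletion n ‖w‖ τ) w).det‖ *
      τ ^ deletion n ‖w‖ τ * (n : ℝ) ^ deletion n ‖w‖ τ := by
  have hn1 : (1 : ℝ) ≤ n := by exact_mod_cast hn
  by_cases h : ‖w‖ < 1 ∧ ‖w‖ ^ n < n * τ
  · have hd : deletion n ‖w‖ τ = 1 := by rw [deletion, if_pos h]
    rw [hd, det_truncatedBlock_one, norm_one, one_mul, pow_one, pow_one]
    exact max_le (by nlinarith) (by linarith [h.2])
  · have hd : deletion n ‖w‖ τ = 0 := by rw [deletion, if_neg h]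
    rw [hd, det_truncatedBlock_zero, norm_pow, pow_zero, pow_zero, mul_one, mul_one]
    refine max_le ?_ le_rfl
    by_cases hw : ‖w‖ < 1
    · have : n * τ ≤ ‖w‖ ^ n := not_lt.1 fun h' => h ⟨hw, h'⟩
      nlinarith
    · exact hτ1.trans (one_le_pow₀ (not_lt.1 hw))

lemma natCast_pow_le_of_le_one {K : ℝ} (hK : 0 < K) (n : ℕ) {d : ℕ} (hd : d ≤ 1) :
    (n : ℝ) ^ d ≤ K ^ d * Real.exp (n / K) := by
  interval_cases d
  · simpa using (by positivity : (0 : ℝ) ≤ n / K)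
  · have h := Real.add_one_le_exp ((n : ℝ) / K)
    have h' : (n : ℝ) / K ≤ Real.exp (n / K) := by linarith
    rw [div_le_iff₀ hK] at h'
    rw [pow_one, pow_one]
    linarith

/-- One term of the exponential series at `N / K` gives `N ^ s ≤ s! K ^ s exp (N / K)`. Thus the
`√s!` of the small ball estimate compensates for `√N ^ s` up to subexponential loss when `s = o(N)`
and `K` is large. -/
lemma sqrt_pow_le_sqrt_factorial {K : ℝ} (hK : 1 ≤ K) (N s : ℕ) :
    √(N : ℝ) ^ s ≤ √(s.factorial : ℝ) * K ^ s * Real.exp (N / K) := by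
  have hK0 : 0 < K := by linarith
  have h := Real.pow_div_factorial_le_exp ((N : ℝ) / K) (by positivity) s
  rw [div_le_iff₀ (by positivity), div_pow, div_le_iff₀ (by positivity)] at h
  refine abs_le_of_sq_le_sq' ?_ (by positivity) |>.2
  rw [← pow_mul, mul_comm s, pow_mul, Real.sq_sqrt (Nat.cast_nonneg N), mul_pow, mul_pow,
    Real.sq_sqrt (Nat.cast_nonneg _)]
  have h1 : K ^ s ≤ (K ^ s) ^ 2 := le_self_pow₀ (one_le_pow₀ hK) two_ne_zero
  have h2 : Real.exp (N / K) ≤ Real.exp (N / K) ^ 2 :=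
    le_self_pow₀ (Real.one_le_exp (by positivity)) two_ne_zero
  calc (N : ℝ) ^ s ≤ Real.exp (N / K) * s.factorial * K ^ s := h
    _ = s.factorial * K ^ s * Real.exp (N / K) := by ring
    _ ≤ _ := by gcongr

/-- The product of the block sizes is dominated by the main term of the expansion of the
determinant. -/
lemma exp_mul_prod_max_le {N : ℕ} (hN : 0 < N) {γ δ : ℝ} (hγ : 1 / 2 < γ)
    (b : Composition N) (c : Fin b.length → ℂ) (z : ℂ) {d : Fin b.length → ℕ}
    (hd : ∀ i, d i = deletion (b.blocksFun i) ‖c i - z‖ ((N : ℝ) ^ (1 / 2 - γ)))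
    {K : ℝ} (hK : 1 ≤ K) (hKδ : 8 / δ ≤ K) (hδ : 0 < δ)
    (hlarge : 2 * (K ^ 2) ^ b.length ≤ Real.exp (δ / 4 * N)) :
    Real.exp (-(δ * N)) * ∏ i, max ((N : ℝ) ^ (1 / 2 - γ)) (‖c i - z‖ ^ b.blocksFun i) ≤
      2⁻¹ * (((N : ℝ) ^ (-γ)) ^ (∑ i, d i) *
        ∏ i, ‖(truncatedBlock (b.blocksFun i) (d i) (c i - z)).det‖) *
          √((∑ i, d i).factorial : ℝ) * Real.exp (-(δ / 2 * N)) := by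
  have hN' : (1 : ℝ) ≤ N := by exact_mod_cast hN
  have hK0 : 0 < K := by linarith
  have hd1 : ∀ i, d i ≤ 1 := fun i => hd i ▸ deletion_le_one _ _ _
  set s := ∑ i, d i with hs
  have hsl : s ≤ b.length := by
    simpa using Finset.sum_le_card_nsmul Finset.univ d 1 fun i _ => hd1 i
  set D := ∏ i, ‖(truncatedBlock (b.blocksFun i) (d i) (c i - z)).det‖
  have hD : 0 ≤ D := Finset.prod_nonneg fun i _ => norm_nonneg _
  -- Each deleted row accounts for `τ = σ √N` in the maxima but only for `σ` in the main term; the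
  -- missing `√N ^ s` is supplied by `√s!`.
  have hτ : (N : ℝ) ^ (1 / 2 - γ) = (N : ℝ) ^ (-γ) * √(N : ℝ) := by
    rw [Real.sqrt_eq_rpow, ← Real.rpow_add (by linarith)]
    ring_nf
  have h1 : ∏ i, max ((N : ℝ) ^ (1 / 2 - γ)) (‖c i - z‖ ^ b.blocksFun i) ≤
      D * ((N : ℝ) ^ (1 / 2 - γ)) ^ s * ∏ i, (b.blocksFun i : ℝ) ^ d i := by
    rw [hs, ← Finset.prod_pow_eq_pow_sum, ← Finset.prod_mul_distrib, ← Finset.prod_mul_distrib]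
    refine Finset.prod_le_prod (fun i _ => by positivity) fun i _ => ?_
    rw [hd i]
    exact max_le_norm_det_truncatedBlock (b.one_le_blocksFun i) (by positivity)
      (Real.rpow_le_one_of_one_le_of_nonpos hN' (by linarith)) _
  have h2 : ∏ i, (b.blocksFun i : ℝ) ^ d i ≤ K ^ s * Real.exp (N / K) := by
    calc ∏ i, (b.blocksFun i : ℝ) ^ d i
        ≤ ∏ i, (K ^ d i * Real.exp (b.blocksFun i / K)) :=
          Finset.prod_le_prod (fun i _ => by positivity) fun i _ =>
            natCast_pow_le_of_le_one hK0 _ (hd1 i)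
      _ = K ^ s * Real.exp (N / K) := by
          rw [Finset.prod_mul_distrib, Finset.prod_pow_eq_pow_sum, ← Real.exp_sum,
            ← Finset.sum_div, ← Nat.cast_sum, b.sum_blocksFun]
  have h3 := sqrt_pow_le_sqrt_factorial hK N s
  have h4 : (K ^ 2) ^ s ≤ 2⁻¹ * Real.exp (δ / 4 * N) := by
    have : (K ^ 2) ^ s ≤ (K ^ 2) ^ b.length := pow_le_pow_right₀ (one_le_pow₀ hK) hsl
    linarith
  -- The choice `K ≥ 8 / δ` makes this loss at most `exp (δ N / 4)`. A second `exp (δ N / 4)` pays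
  -- for `2 (K ^ 2) ^ s`, so half of the exponent `δ N` is left.
  have h5 : Real.exp (N / K) ^ 2 ≤ Real.exp (δ / 4 * N) := by
    rw [← Real.exp_nat_mul, Real.exp_le_exp]
    rw [div_le_iff₀ hδ] at hKδ
    push_cast
    rw [mul_div_assoc', div_le_iff₀ hK0]
    nlinarith
  have hσ : 0 ≤ ((N : ℝ) ^ (-γ)) ^ s := by positivity
  calc Real.exp (-(δ * N)) * ∏ i, max ((N : ℝ) ^ (1 / 2 - γ)) (‖c i - z‖ ^ b.blocksFun i)
      ≤ Real.exp (-(δ * N)) * (D * ((N : ℝ) ^ (1 / 2 - γ)) ^ s * (K ^ s * Real.exp (N / K))) := by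
        refine mul_le_mul_of_nonneg_left (h1.trans ?_) (Real.exp_pos _).le
        exact mul_le_mul_of_nonneg_left h2 (by positivity)
    _ = Real.exp (-(δ * N)) * (D * ((N : ℝ) ^ (-γ)) ^ s) * (K ^ s * Real.exp (N / K)) *
          √(N : ℝ) ^ s := by
        rw [hτ, mul_pow]
        ring
    _ ≤ Real.exp (-(δ * N)) * (D * ((N : ℝ) ^ (-γ)) ^ s) * (K ^ s * Real.exp (N / K)) *
          (√(s.factorial : ℝ) * K ^ s * Real.exp (N / K)) := by
        gcongr
    _ = Real.exp (-(δ * N)) * (D * ((N : ℝ) ^ (-γ)) ^ s) * √(s.factorial : ℝ) *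
          ((K ^ 2) ^ s * Real.exp (N / K) ^ 2) := by
        ring
    _ ≤ Real.exp (-(δ * N)) * (D * ((N : ℝ) ^ (-γ)) ^ s) * √(s.factorial : ℝ) *
          (2⁻¹ * Real.exp (δ / 4 * N) * Real.exp (δ / 4 * N)) := by
        gcongr
    _ = 2⁻¹ * (((N : ℝ) ^ (-γ)) ^ s * D) * √(s.factorial : ℝ) *
          (Real.exp (-(δ * N)) * (Real.exp (δ / 4 * N) * Real.exp (δ / 4 * N))) := by
        ring
    _ = _ := by
        rw [← Real.exp_add, ← Real.exp_add]
        ring_nf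

/-! ### Passage to the limit. -/

/-- Exponentials of sublinear sequences are negligible against exponential decay. -/
lemma tendsto_pow_mul_exp_neg {l : ℕ → ℕ}
    (hl : (fun N : ℕ => (l N : ℝ)) =o[atTop] fun N : ℕ => (N : ℝ)) {K a : ℝ} (hK : 1 ≤ K)
    (ha : 0 < a) :
    Tendsto (fun N : ℕ => K ^ l N * Real.exp (-(a * N))) atTop (𝓝 0) := by
  have hlog : 0 ≤ Real.log K := Real.log_nonneg hK
  have hev := hl.def (show (0 : ℝ) < a / 2 / (Real.log K + 1) by positivity)
  have hlim : Tendsto (fun N : ℕ => Real.exp (-(a / 2 * N))) atTop (𝓝 0) :=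
    Real.tendsto_exp_neg_atTop_nhds_zero.comp
      (tendsto_natCast_atTop_atTop.const_mul_atTop (by positivity))
  refine squeeze_zero' (.of_forall fun N => by positivity) ?_ hlim
  filter_upwards [hev] with N h
  rw [Real.norm_of_nonneg (Nat.cast_nonneg _), Real.norm_of_nonneg (Nat.cast_nonneg _),
    div_mul_eq_mul_div, le_div_iff₀ (by positivity)] at h
  have hexp : K ^ l N = Real.exp (l N * Real.log K) := by
    rw [Real.exp_nat_mul, Real.exp_log (by linarith)]
  rw [hexp, ← Real.exp_add, Real.exp_le_exp]
  have : (0 : ℝ) ≤ l N := Nat.cast_nonneg _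
  linarith

/-- Asymptotic lower bound for the logarithmic potential of the spectrum of a perturbed Jordan
matrix. -/
theorem proposition4p1 {Ω : Type*} [MeasurableSpace Ω] (P : Measure Ω) [IsProbabilityMeasure P]
    (γ ε : ℝ) (hγ : 1 / 2 < γ) (hε : 0 < ε) (hεγ : ε < 2 * γ - 1)
    (b : (N : ℕ) → Composition N) (c : (N : ℕ) → Fin (b N).length → ℂ)
    (hℓ : (fun N : ℕ => ((b N).length : ℝ)) =o[atTop] fun N : ℕ => (N : ℝ))
    (G : (N : ℕ) → Ω → Matrix (Fin N) (Fin N) ℝ)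
    (hG : ∀ N, IsStandardGaussianMatrix P (G N))
    (z : ℕ → ℂ) (hz : ∀ᶠ N in atTop, z N ∈ stableSet γ ε (b N) (c N))
    (δ : ℝ) (hδ : 0 < δ) :
    Tendsto
      (fun N : ℕ => P {ω |
        logPotential
            (empiricalSpectralMeasure
              (perturbedMatrix γ (jordanMatrix (b N) (c N)) (G N ω))) (z N) ≤
          logPotential (circleMixture γ (b N) (c N)) (z N) - (δ : EReal)})
      atTop (𝓝 0) := by
  set K : ℝ := max 1 (8 / δ) with hK
  have hK1 : 1 ≤ K := le_max_left _ _
  have hKδ : 8 / δ ≤ K := le_max_right _ _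
  set T : ℕ → ℝ := fun N => (N : ℝ) ^ (-ε) + (b N).length / N with hT
  have hT0 : Tendsto T atTop (𝓝 0) := by
    have h1 : Tendsto (fun N : ℕ => (N : ℝ) ^ (-ε)) atTop (𝓝 0) :=
      (tendsto_rpow_neg_atTop hε).comp tendsto_natCast_atTop_atTop
    simpa using h1.add hℓ.tendsto_div_nhds_zero
  have hbound : Tendsto (fun N : ℕ => 4 * ENNReal.ofReal (4 * T N / (1 - 4 * T N)) +
      ENNReal.ofReal (6 ^ (b N).length * Real.exp (-(δ / 4 * N)))) atTop (𝓝 0) := by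
    have h1 : Tendsto (fun N => 4 * T N / (1 - 4 * T N)) atTop (𝓝 0) := by
      have h := (hT0.const_mul 4).div (tendsto_const_nhds.sub (hT0.const_mul 4))
        (show (1 : ℝ) - 4 * 0 ≠ 0 by norm_num)
      simpa [Pi.div_def] using h
    have h2 := ENNReal.tendsto_ofReal
      (tendsto_pow_mul_exp_neg hℓ (K := 6) (by norm_num) (show 0 < δ / 4 by positivity))
    have h3 := ENNReal.Tendsto.const_mul (a := 4) (ENNReal.tendsto_ofReal h1) (.inr (by simp))
    simpa using h3.add h2
  have hlarge : ∀ᶠ N : ℕ in atTop, 2 * (K ^ 2) ^ (b N).length ≤ Real.exp (δ / 4 * N) := by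
    have h := (tendsto_pow_mul_exp_neg hℓ (one_le_pow₀ hK1 : 1 ≤ K ^ 2)
      (show 0 < δ / 4 by positivity)).eventually (gt_mem_nhds (show (0 : ℝ) < 2⁻¹ by norm_num))
    filter_upwards [h] with N h
    rw [Real.exp_neg, ← div_eq_mul_inv, div_lt_iff₀ (Real.exp_pos _)] at h
    linarith
  have hTsmall : ∀ᶠ N in atTop, 4 * T N < 1 := by
    filter_upwards [hT0.eventually (gt_mem_nhds (show (0 : ℝ) < 1 / 4 by norm_num))] with N h
    linarith
  refine tendsto_of_tendsto_of_tendsto_of_le_of_le' tendsto_const_nhds hbound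
    (.of_forall fun N => zero_le) ?_
  filter_upwards [hz, hlarge, hTsmall, eventually_gt_atTop 1] with N hzN hlN hTN hN
  set d : Fin (b N).length → ℕ := fun i =>
    deletion ((b N).blocksFun i) ‖c N i - z N‖ ((N : ℝ) ^ (1 / 2 - γ)) with hd
  -- The choice `θ = exp (-δ N / 2)` matches the slack in the deterministic comparison, and `√θ =
  -- exp (-δ N / 4)` still beats `6 ^ s ≤ 6 ^ ℓ`.
  have hmain := measure_norm_det_perturbedMatrix_le (by omega) (b N) (c N) (hG N) hzN
    (d := d) (fun i => rfl) (T := T N) rfl hTN (Real.exp_pos (-(δ / 2 * N)))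
  have hsub := measure_mono (μ := P) fun ω (hω : ω ∈ {ω |
      logPotential (empiricalSpectralMeasure
        (perturbedMatrix γ (jordanMatrix (b N) (c N)) (G N ω))) (z N) ≤
          logPotential (circleMixture γ (b N) (c N)) (z N) - (δ : EReal)}) =>
    (norm_det_le_of_logPotential_le hN (b N) (c N) _ hω).trans
      (exp_mul_prod_max_le (by omega) hγ (b N) (c N) (z N) (d := d) (fun i => rfl) hK1 hKδ hδ hlN)
  refine (hsub.trans hmain).trans (add_le_add le_rfl ?_)
  have hsl : ∑ i, d i ≤ (b N).length := by
    simpa using Finset.sum_le_card_nsmul Finset.univ d 1 fun i _ => deletion_le_one _ _ _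
  have hsqrt : √(Real.exp (-(δ / 2 * N))) = Real.exp (-(δ / 4 * N)) := by
    rw [Real.sqrt_eq_rpow, ← Real.exp_mul]
    ring_nf
  rw [hsqrt, ENNReal.ofReal_mul (by positivity), ENNReal.ofReal_pow (by norm_num)]
  gcongr
  · simp
  · simp
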